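/- Consider a two-player zero-sum Markov game with finite state space $\mathcal S$, finite action spaces $\mathcal A_1,\mathcal A_2$, horizon $T$, initial distribution $P_I$, transition probabilities $P_T$, reward distributions $P_R$ with mean $R$, and discount factor $\gamma\in[0,1]$; player 1 receives the reward $r_t$ and player 2 receives $-r_t$. Let $\pi=(\pi_1,\pi_2)$ be a target profile and $\pi^b=(\pi^b_1,\pi^b_2)$ a behavior profile of (time-dependent) Markov policies, and write $a_t=(a^1_t,a^2_t)$, $\pi_t(a_t\mid s_t)=\pi_{1,t}(a^1_t\mid s_t)\pi_{2,t}(a^2_t\mid s_t)$, and similarly $\pi^b_t$. Let $v_1=v_1(\pi_1,\pi_2)=\mathbb E_{\pi}[\sum_{t=1}^T\gamma^{t-1}r_t]$, $v_2=-v_1$, $V_{1,t}(s)=\mathbb E_\pi[\sum_{k=t}^T\gamma^{k-t}r_k\mid s_t=s]$, $V_{1,T+1}=0$, $Q_{1,t}(s,a)=R(s,a)+\gamma\,\mathbb E_{s'\sim P_T(\cdot\mid s,a)}[V_{1,t+1}(s')]$, and $\rho_t=\prod_{k=1}^t\eta_k$ with $\eta_k=\pi_k(a_k\mid s_k)/\pi^b_k(a_k\mid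 s_k)$, $\rho_0=1$. Assume that $\pi_t(a\mid s)\le C\,\pi^b_t(a\mid s)$ for all $t,s,a$ (that is, $0\le\eta_t\le C$) and $|r_t|\le R_{\max}$ for all $t$. Let $\mathcal D$ consist of $n$ independent trajectories $(s_1,a_1,r_1,\dots,s_T,a_T,r_T,s_{T+1})$ generated by $\pi^b$, split into $K$ evenly-sized folds ($K$ fixed). For each fold $k$, let $\hat Q^{-k}_{1,t}$ (a function of $(s_t,a_t)$) and $\hat\rho^{-k}_t$ (a function of $(s_1,a_1,\dots,s_t,a_t)$, with $\hat\rho^{-k}_0=1$) be estimates of $Q_{1,t}$ and $\rho_t$ computed from the data outside fold $k$, such that, almost surely, $0\le\hat\rho^{-k}_t\le C^t$ and $|\hat Q^{-k}_{1,t}|\le(T+1-t)R_{\max}$ for $1\le t\le T$. With $k(i)$ the fold that contains trajectory $i$ and $\hat V_t^{-k}(s)=\sum_{a}\pi_t(a\mid s)\hat Q_{1,t}^{-k}(s,a)$, define $$\hat v_1^{\mathrm{DR}}=\frac1n\sum_{i=1}^n\sum_{t=1}^T\gamma^{t-1}\Bigl(\hat\rho^{-k(i)}_t\bigl(r_{t}-\hat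 Q^{-k(i)}_{1,t}\bigr)+\hat\rho^{-k(i)}_{t-1}\hat V^{-k(i)}_t\Bigr),\qquad \hat v_2^{\mathrm{DR}}=-\hat v_1^{\mathrm{DR}},$$ where the inner sum is evaluated at the $i$-th trajectory. Let $\|\cdot\|_2$ be the $L^2$ norm under the law of a fresh trajectory generated by $\pi^b$, and suppose that for all $1\le t\le T$ and $1\le k\le K$, as $n\to\infty$, $$\|\hat Q^{-k}_{1,t}-Q_{1,t}\|_2=o_p(n^{-\alpha_1}),\qquad \|\hat\rho^{-k}_t-\rho_t\|_2=o_p(n^{-\alpha_2}),$$ where $\alpha_1>0$, $\alpha_2>0$ and $\alpha_1+\alpha_2\ge 1/2$. Then $$\sqrt n\,(\hat v^{\mathrm{DR}}_1-v_1)\xrightarrow{d}\mathcal N(0,\Upsilon^{\mathrm{DR}}),\qquad \sqrt n\,(\hat v^{\mathrm{DR}}_2-v_2)\xrightarrow{d}\mathcal N(0,\Upsilon^{\mathrm{DR}}),$$ $$\Upsilon^{\mathrm{DR}}=\mathbb V[V_{1,1}(s_1)]+\sum_{t=1}^T\mathbb E\Bigl[\gamma^{2(t-1)}\rho_t^2\,\mathbb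 V\bigl[r_t+\gamma V_{1,t+1}(s_{t+1})\mid s_1,a_1,\dots,s_t,a_t\bigr]\Bigr],$$ where expectations and (conditional) variances are under the law of a trajectory generated by $\pi^b$. -/

import Mathlib

open MeasureTheory ProbabilityTheory Filter
open scoped ENNReal NNReal

noncomputable section

/-- A two-player zero-sum Markov game with state space `S`, action spaces `A₁`, `A₂`: horizon,
initial distribution, transition probabilities, reward distributions, discount factor.
Player 1 receives the reward, player 2 its negative. -/
structure MarkovGame (S A₁ A₂ : Type*) where
  /-- the horizon `T` -/
  horizon : ℕ
  /-- the initial state distribution `P_I` -/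
  init : PMF S
  /-- the transition probabilities `P_T` -/
  trans : S → A₁ × A₂ → PMF S
  /-- the reward distributions `P_R` -/
  reward : S → A₁ × A₂ → Measure ℝ
  reward_prob : ∀ s a, IsProbabilityMeasure (reward s a)
  /-- the discount factor -/
  γ : ℝ
  γ_nonneg : 0 ≤ γ
  γ_le_one : γ ≤ 1

/-- A profile of Markov policies. Steps are numbered from `0`; in a game of horizon `T` only the
policies at steps `0, …, T - 1` matter. -/
structure PolicyProfile (S A₁ A₂ : Type*) where
  fst : ℕ → S → PMF A₁
  snd : ℕ → S → PMF A₂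

/-- Probability `π_{1,t}(a¹ | s) π_{2,t}(a² | s)` of the joint action `a = (a¹, a²)`. -/
def PolicyProfile.prob {S A₁ A₂ : Type*} (π : PolicyProfile S A₁ A₂) (t : ℕ) (s : S)
    (a : A₁ × A₂) : ℝ≥0∞ :=
  π.fst t s a.1 * π.snd t s a.2

/-- Trajectories of `m` steps: the `m + 1` states, the `m` joint actions, the `m` rewards. -/
abbrev Traj (S A₁ A₂ : Type*) (m : ℕ) : Type _ :=
  (Fin (m + 1) → S) × (Fin m → A₁ × A₂) × (Fin m → ℝ)

/-- The states and joint actions of the first `m` steps. -/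
abbrev Hist (S A₁ A₂ : Type*) (m : ℕ) : Type _ := Fin m → S × (A₁ × A₂)

namespace Traj

variable {S A₁ A₂ : Type*} {m : ℕ}

/-- the state at step `t` -/
def state (τ : Traj S A₁ A₂ m) (t : Fin (m + 1)) : S := τ.1 t

/-- the joint action at step `t` -/
def action (τ : Traj S A₁ A₂ m) (t : Fin m) : A₁ × A₂ := τ.2.1 t

/-- the reward at step `t` -/
def rew (τ : Traj S A₁ A₂ m) (t : Fin m) : ℝ := τ.2.2 t

/-- the state-action history of the first `l` steps -/
def hist (l : ℕ) (hl : l ≤ m) (τ : Traj S A₁ A₂ m) : Hist S A₁ A₂ l :=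
  fun j => (τ.state (Fin.castLE hl j).castSucc, τ.action (Fin.castLE hl j))

/-- the discounted return `∑ γ ^ j r_j` -/
def discountedReturn (γ : ℝ) (τ : Traj S A₁ A₂ m) : ℝ := ∑ j : Fin m, γ ^ (j : ℕ) * τ.rew j

end Traj

/-- The density ratio `η_t(s, a)` of the target profile `π` to the behavior profile `πb`. -/
def densityRatio {S A₁ A₂ : Type*} (π πb : PolicyProfile S A₁ A₂) (t : ℕ) (s : S)
    (a : A₁ × A₂) : ℝ :=
  (π.prob t s a).toReal / (πb.prob t s a).toReal

/-- The cumulative density ratio over the first `l` steps, as a function of the history. -/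
def cumRatio {S A₁ A₂ : Type*} (π πb : PolicyProfile S A₁ A₂) (l : ℕ) (h : Hist S A₁ A₂ l) : ℝ :=
  ∏ j : Fin l, densityRatio π πb j (h j).1 (h j).2

namespace MarkovGame

variable {S A₁ A₂ : Type*} [Fintype S] [MeasurableSpace S]
  [Fintype A₁] [MeasurableSpace A₁] [Fintype A₂] [MeasurableSpace A₂]

/-- Law of the states, actions and rewards of `m` consecutive steps `t₀, …, t₀ + m - 1` when the
state at step `t₀` has law `p₀` and the profile `π` is played: the mixture, over all sequences of
states and joint actions, with weights
`p₀(s_0) ∏ π_{1,t₀+j}(a¹_j | s_j) π_{2,t₀+j}(a²_j | s_j) P_T(s_{j+1} | s_j, a_j)`, of the laws with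
independent rewards `r_j ∼ P_R(s_j, a_j)`. -/
def pathLaw (G : MarkovGame S A₁ A₂) (π : PolicyProfile S A₁ A₂) (t₀ m : ℕ) (p₀ : PMF S) :
    Measure (Traj S A₁ A₂ m) :=
  ∑ x : (Fin (m + 1) → S) × (Fin m → A₁ × A₂),
    (p₀ (x.1 0) * ∏ j : Fin m, π.prob (t₀ + j) (x.1 j.castSucc) (x.2 j) *
        G.trans (x.1 j.castSucc) (x.2 j) (x.1 j.succ)) •
      (Measure.pi fun j : Fin m => G.reward (x.1 j.castSucc) (x.2 j)).map
        fun r => ((x.1, x.2, r) : Traj S A₁ A₂ m)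

/-- The law of a full trajectory of the game under `π`. -/
def law (G : MarkovGame S A₁ A₂) (π : PolicyProfile S A₁ A₂) :
    Measure (Traj S A₁ A₂ G.horizon) :=
  G.pathLaw π 0 G.horizon G.init

/-- The value `v_1(π_1, π_2)`: expected discounted return of player 1. -/
def value₁ (G : MarkovGame S A₁ A₂) (π : PolicyProfile S A₁ A₂) : ℝ :=
  ∫ τ, τ.discountedReturn G.γ ∂G.law π

/-- The value `v_2(π_1, π_2)` of player 2. -/
def value₂ (G : MarkovGame S A₁ A₂) (π : PolicyProfile S A₁ A₂) : ℝ := -G.value₁ π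

/-- The state value function: expected discounted return of player 1 over the steps
`t, …, T - 1` when the state at step `t` is `s`. It vanishes at `t = T`. -/
def stateValue (G : MarkovGame S A₁ A₂) (π : PolicyProfile S A₁ A₂) (t : ℕ) (s : S) : ℝ :=
  ∫ τ, τ.discountedReturn G.γ ∂G.pathLaw π t (G.horizon - t) (PMF.pure s)

/-- The mean reward function. -/
def meanReward (G : MarkovGame S A₁ A₂) (s : S) (a : A₁ × A₂) : ℝ := ∫ r, r ∂G.reward s a

/-- The state-action value function of player 1. -/
def qValue (G : MarkovGame S A₁ A₂) (π : PolicyProfile S A₁ A₂) (t : ℕ) (s : S) (a : A₁ × A₂) :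
    ℝ :=
  G.meanReward s a + ∑ s', (G.trans s a s').toReal * (G.γ * G.stateValue π (t + 1) s')

/-- The `L²` distance of an estimate of the state-action value function at step `t` from the
truth, under the law of a trajectory of the behavior profile. -/
def qError (G : MarkovGame S A₁ A₂) (π πb : PolicyProfile S A₁ A₂) (t : Fin G.horizon)
    (q : S → A₁ × A₂ → ℝ) : ℝ :=
  √(∫ τ, (q (τ.state t.castSucc) (τ.action t) -
    G.qValue π t (τ.state t.castSucc) (τ.action t)) ^ 2 ∂G.law πb)

/-- The `L²` distance of an estimate of the cumulative density ratio through step `t` (that is,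
over `t + 1` steps) from the truth, under the law of a trajectory of the behavior profile. -/
def ratioError (G : MarkovGame S A₁ A₂) (π πb : PolicyProfile S A₁ A₂) (t : Fin G.horizon)
    (w : Hist S A₁ A₂ (t + 1) → ℝ) : ℝ :=
  √(∫ τ, (w (τ.hist (t + 1) t.2) - cumRatio π πb (t + 1) (τ.hist (t + 1) t.2)) ^ 2 ∂G.law πb)

/-- The contribution of a trajectory to the doubly robust estimator, for a nuisance estimate `q` of
the state-action value functions and `w` of the cumulative density ratios (`w l` is the ratio over
the first `l` steps). The sum over `a` is the mean of `q t` at the current state under `π`. -/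
def drScore (G : MarkovGame S A₁ A₂) (π : PolicyProfile S A₁ A₂)
    (q : Fin G.horizon → S → A₁ × A₂ → ℝ) (w : (l : ℕ) → Hist S A₁ A₂ l → ℝ)
    (τ : Traj S A₁ A₂ G.horizon) : ℝ :=
  ∑ t : Fin G.horizon, G.γ ^ (t : ℕ) *
    (w (t + 1) (τ.hist (t + 1) t.2) * (τ.rew t - q t (τ.state t.castSucc) (τ.action t)) +
      w t (τ.hist t t.2.le) *
        ∑ a : A₁ × A₂, (π.prob t (τ.state t.castSucc) a).toReal * q t (τ.state t.castSucc) a)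

/-- The asymptotic variance `Υ^DR`; expectations and conditional variances are under the law of a
trajectory of the behavior profile, and the conditioning is on the states and actions of the steps
`0, …, t`. -/
def drVariance (G : MarkovGame S A₁ A₂) (π πb : PolicyProfile S A₁ A₂) : ℝ :=
  Var[fun s => G.stateValue π 0 s; G.init.toMeasure] +
    ∑ t : Fin G.horizon, ∫ τ, G.γ ^ (2 * (t : ℕ)) *
      cumRatio π πb (t + 1) (τ.hist (t + 1) t.2) ^ 2 *
      (Var[fun τ' : Traj S A₁ A₂ G.horizon =>
          τ'.rew t + G.γ * G.stateValue π (t + 1) (τ'.state t.succ); G.law πb |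
        MeasurableSpace.comap (Traj.hist ((t : ℕ) + 1) t.2) inferInstance]) τ ∂G.law πb

/-- The asymptotic variance is nonnegative, so that `Real.toNNReal` does not change it. -/
theorem drVariance_nonneg (G : MarkovGame S A₁ A₂) (π πb : PolicyProfile S A₁ A₂) :
    0 ≤ G.drVariance π πb := by
  refine add_nonneg (variance_nonneg _ _) (Finset.sum_nonneg fun t _ => ?_)
  refine integral_nonneg_of_ae ?_
  have h : ∀ᵐ τ ∂G.law πb, 0 ≤ (Var[fun τ' : Traj S A₁ A₂ G.horizon =>
          τ'.rew t + G.γ * G.stateValue π (t + 1) (τ'.state t.succ); G.law πb |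
        MeasurableSpace.comap (Traj.hist ((t : ℕ) + 1) t.2) inferInstance]) τ :=
    condExp_nonneg (ae_of_all _ fun τ => sq_nonneg _)
  filter_upwards [h] with τ hτ
  exact mul_nonneg (mul_nonneg (pow_nonneg G.γ_nonneg _) (sq_nonneg _)) hτ

end MarkovGame

/-- The part of a sample of size `n` outside fold `k`, for the fold assignment `f`. -/
def trainingData {X : Type*} {n K : ℕ} (f : Fin n → Fin K) (k : Fin K) (x : Fin n → X) :
    {i : Fin n // f i ≠ k} → X :=
  fun i => x i

/-- The folds of the assignment `f` have sizes that differ by at most one. -/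
def IsEvenSplit {n K : ℕ} (f : Fin n → Fin K) : Prop :=
  ∀ k k' : Fin K, Fintype.card {i // f i = k} ≤ Fintype.card {i // f i = k'} + 1

/-- The cross-fitted doubly robust estimator of `v_1` from the sample `x`: `Qhat k` and `ρhat k` are
the procedures that compute the nuisance estimates from the data outside fold `k`. -/
def drEstimator₁ {S A₁ A₂ : Type*} [Fintype A₁] [Fintype A₂]
    (G : MarkovGame S A₁ A₂) (π : PolicyProfile S A₁ A₂) {n K : ℕ} (f : Fin n → Fin K)
    (Qhat : (k : Fin K) → ({i : Fin n // f i ≠ k} → Traj S A₁ A₂ G.horizon) →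
      Fin G.horizon → S → A₁ × A₂ → ℝ)
    (ρhat : (k : Fin K) → ({i : Fin n // f i ≠ k} → Traj S A₁ A₂ G.horizon) →
      (l : ℕ) → Hist S A₁ A₂ l → ℝ)
    (x : Fin n → Traj S A₁ A₂ G.horizon) : ℝ :=
  (n : ℝ)⁻¹ * ∑ i, G.drScore π (Qhat (f i) (trainingData f (f i) x))
    (ρhat (f i) (trainingData f (f i) x)) (x i)

/-- The cross-fitted doubly robust estimator of `v_2`. -/
def drEstimator₂ {S A₁ A₂ : Type*} [Fintype A₁] [Fintype A₂]
    (G : MarkovGame S A₁ A₂) (π : PolicyProfile S A₁ A₂) {n K : ℕ} (f : Fin n → Fin K)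
    (Qhat : (k : Fin K) → ({i : Fin n // f i ≠ k} → Traj S A₁ A₂ G.horizon) →
      Fin G.horizon → S → A₁ × A₂ → ℝ)
    (ρhat : (k : Fin K) → ({i : Fin n // f i ≠ k} → Traj S A₁ A₂ G.horizon) →
      (l : ℕ) → Hist S A₁ A₂ l → ℝ)
    (x : Fin n → Traj S A₁ A₂ G.horizon) : ℝ :=
  -drEstimator₁ G π f Qhat ρhat x

end

/-! Let `ψ` be the score with the true nuisance functions and `Δ` the score with the estimates minus
`ψ`. Then `√n (v̂₁ - v₁)` is the normalized centred sum of `ψ (X i)` plus `n ^ (-1/2)` times the sum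
of `Δ (X i)`, where `Δ` is built from the data outside the fold of `i`. The first part obeys the
classical central limit theorem, the second tends to zero in probability, and Slutsky's lemma joins
them. The claim for `v₂` follows from the symmetry of the centred Gaussian.

Mean and variance of `ψ`: by the Bellman equation the score with the true `Q` and any weights `w`
with `w 0 = 1` telescopes to `V₀(s₀) + ∑ γ^t w_{t+1} δ_t`, where `δ_t = r_t + γ V_{t+1}(s_{t+1}) -
Q_t(s_t, a_t)` (`drScore_qValue_eq`). Each `δ_t` has mean zero given what precedes the reward of
step `t` (`integral_mul_reward_residual`). Hence the mean is `v₁` whatever the weights, and for the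
true ratios the summands are orthogonal, which gives `Υ` (`integral_drScore_sub_sq`).

Remainder: the trajectories of fold `k` are independent of the data outside it, so with the
estimates frozen Chebyshev's inequality bounds the fold's contribution by `E Δ² + n (E Δ)²`
(`tendstoInMeasure_crossFit`). The term `E Δ²` is at most a constant times the squared nuisance
errors (`exists_integral_drScore_sub_sq_le`). For the bias, the true `Q` makes errors in the weights
harmless, and the true weights make errors in `Q` harmless, because importance weighting turns the
behavior action into a target action (`integral_cumRatio_mul`). Only products of the two errors
survive (`mul_abs_integral_drScore_sub_le`), and these are `o_p(n ^ (-1/2))` since `α₁ + α₂ ≥ 1/2`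
(`tendstoInMeasure_remainder`). -/

/-- A trajectory preceded by one more step. -/
def Traj.cons {S A₁ A₂ : Type*} {m : ℕ} (s : S) (a : A₁ × A₂) (r : ℝ) (τ : Traj S A₁ A₂ m) :
    Traj S A₁ A₂ (m + 1) :=
  (Fin.cons s τ.1, Fin.cons a τ.2.1, Fin.cons r τ.2.2)

/-! ### Probability weights and the first-step decomposition of the path law. -/

theorem PMF.sum_coe_fintype {α : Type*} [Fintype α] (p : PMF α) : ∑ a, p a = 1 := by
  rw [← tsum_fintype (L := .unconditional α)]
  exact p.tsum_coe

theorem PMF.sum_toReal {α : Type*} [Fintype α] (p : PMF α) : ∑ a, (p a).toReal = 1 := by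
  rw [← ENNReal.toReal_sum fun a _ => p.apply_ne_top a, p.sum_coe_fintype, ENNReal.toReal_one]

namespace PolicyProfile

variable {S A₁ A₂ : Type*}

theorem prob_ne_top (π : PolicyProfile S A₁ A₂) (t : ℕ) (s : S) (a : A₁ × A₂) :
    π.prob t s a ≠ ∞ :=
  ENNReal.mul_ne_top (PMF.apply_ne_top _ _) (PMF.apply_ne_top _ _)

theorem sum_prob [Fintype A₁] [Fintype A₂] (π : PolicyProfile S A₁ A₂) (t : ℕ) (s : S) :
    ∑ a, π.prob t s a = 1 := by
  simp_rw [PolicyProfile.prob, Fintype.sum_prod_type, ← Finset.mul_sum, PMF.sum_coe_fintype, mul_one,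
    PMF.sum_coe_fintype]

theorem sum_prob_toReal [Fintype A₁] [Fintype A₂] (π : PolicyProfile S A₁ A₂) (t : ℕ) (s : S) :
    ∑ a, (π.prob t s a).toReal = 1 := by
  rw [← ENNReal.toReal_sum fun a _ => π.prob_ne_top t s a, π.sum_prob, ENNReal.toReal_one]

end PolicyProfile

/-- Integration over a finite product of measures, the first coordinate separately. -/
theorem lintegral_pi_cons {m : ℕ} (μ : Fin (m + 1) → Measure ℝ) [∀ i, SigmaFinite (μ i)]
    {f : (Fin (m + 1) → ℝ) → ℝ≥0∞} (hf : Measurable f) :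
    ∫⁻ r, f r ∂Measure.pi μ =
      ∫⁻ r₀, ∫⁻ r, f (Fin.cons r₀ r) ∂Measure.pi (fun j : Fin m => μ j.succ) ∂μ 0 := by
  have h := (measurePreserving_piFinSuccAbove μ 0).symm
  rw [← h.lintegral_comp hf, lintegral_prod]
  · simp [MeasurableEquiv.piFinSuccAbove, Fin.insertNthEquiv]
  · exact (hf.comp (MeasurableEquiv.measurable _)).aemeasurable

namespace MarkovGame

variable {S A₁ A₂ : Type*} [MeasurableSpace S] [MeasurableSpace A₁] [MeasurableSpace A₂]

instance (G : MarkovGame S A₁ A₂) (s : S) (a : A₁ × A₂) : IsProbabilityMeasure (G.reward s a) :=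
  G.reward_prob s a

theorem measurable_traj_mk {m : ℕ} (x : (Fin (m + 1) → S) × (Fin m → A₁ × A₂)) :
    Measurable fun r : Fin m → ℝ => ((x.1, x.2, r) : Traj S A₁ A₂ m) := by
  fun_prop

theorem measurable_traj_cons {m : ℕ} (s : S) (a : A₁ × A₂) :
    Measurable fun p : ℝ × Traj S A₁ A₂ m => Traj.cons s a p.1 p.2 := by
  refine Measurable.prodMk ?_ (Measurable.prodMk ?_ ?_) <;>
    refine measurable_pi_iff.2 fun j => ?_ <;>
    refine Fin.cases ?_ (fun j => ?_) j <;> simp only [Fin.cons_zero, Fin.cons_succ] <;> fun_prop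

variable [Fintype S] [Fintype A₁] [Fintype A₂]

theorem lintegral_pathLaw (G : MarkovGame S A₁ A₂) (π : PolicyProfile S A₁ A₂) (t₀ m : ℕ)
    (p₀ : PMF S) {f : Traj S A₁ A₂ m → ℝ≥0∞} (hf : Measurable f) :
    ∫⁻ τ, f τ ∂G.pathLaw π t₀ m p₀ = ∑ x : (Fin (m + 1) → S) × (Fin m → A₁ × A₂),
      (p₀ (x.1 0) * ∏ j : Fin m, π.prob (t₀ + j) (x.1 j.castSucc) (x.2 j) *
        G.trans (x.1 j.castSucc) (x.2 j) (x.1 j.succ)) *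
      ∫⁻ r, f (x.1, x.2, r) ∂Measure.pi fun j : Fin m => G.reward (x.1 j.castSucc) (x.2 j) := by
  rw [pathLaw, lintegral_finsetSum_measure]
  refine Finset.sum_congr rfl fun x _ => ?_
  rw [lintegral_smul_measure, lintegral_map hf (measurable_traj_mk x), smul_eq_mul]

instance isFiniteMeasure_pathLaw (G : MarkovGame S A₁ A₂) (π : PolicyProfile S A₁ A₂) (t₀ m : ℕ)
    (p₀ : PMF S) : IsFiniteMeasure (G.pathLaw π t₀ m p₀) := by
  refine ⟨?_⟩
  rw [← lintegral_one, lintegral_pathLaw _ _ _ _ _ measurable_const]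
  simp only [lintegral_const, measure_univ, mul_one]
  refine ENNReal.sum_lt_top.2 fun x _ => ENNReal.mul_lt_top (PMF.apply_lt_top _ _) ?_
  exact ENNReal.prod_lt_top fun j _ =>
    ENNReal.mul_lt_top (π.prob_ne_top _ _ _).lt_top (PMF.apply_lt_top _ _)

/-- Decomposition of the law of a trajectory at its first step. -/
theorem pathLaw_succ (G : MarkovGame S A₁ A₂) (π : PolicyProfile S A₁ A₂) (t₀ m : ℕ)
    (p₀ : PMF S) :
    G.pathLaw π t₀ (m + 1) p₀ = ∑ z : (S × (A₁ × A₂)) × S,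
      (p₀ z.1.1 * π.prob t₀ z.1.1 z.1.2 * G.trans z.1.1 z.1.2 z.2) •
        ((G.reward z.1.1 z.1.2).prod (G.pathLaw π (t₀ + 1) m (PMF.pure z.2))).map
          fun p => Traj.cons z.1.1 z.1.2 p.1 p.2 := by
  classical
  refine Measure.ext_of_lintegral _ fun f hf => ?_
  rw [lintegral_pathLaw _ _ _ _ _ hf, lintegral_finsetSum_measure]
  have key : ∀ z : (S × (A₁ × A₂)) × S,
      ∫⁻ τ, f τ ∂((p₀ z.1.1 * π.prob t₀ z.1.1 z.1.2 * G.trans z.1.1 z.1.2 z.2) •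
        ((G.reward z.1.1 z.1.2).prod (G.pathLaw π (t₀ + 1) m (PMF.pure z.2))).map
          fun p => Traj.cons z.1.1 z.1.2 p.1 p.2) =
      ∑ x : (Fin (m + 1) → S) × (Fin m → A₁ × A₂),
        (p₀ z.1.1 * π.prob t₀ z.1.1 z.1.2 * G.trans z.1.1 z.1.2 z.2) *
        ((PMF.pure z.2 (x.1 0) * ∏ j : Fin m, π.prob (t₀ + 1 + j) (x.1 j.castSucc) (x.2 j) *
        G.trans (x.1 j.castSucc) (x.2 j) (x.1 j.succ)) *
        ∫⁻ r₀, ∫⁻ r, f (Traj.cons z.1.1 z.1.2 r₀ (x.1, x.2, r))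
          ∂(Measure.pi fun j : Fin m => G.reward (x.1 j.castSucc) (x.2 j))
          ∂(G.reward z.1.1 z.1.2)) := by
    intro z
    have hfc : Measurable fun p : ℝ × Traj S A₁ A₂ m => f (Traj.cons z.1.1 z.1.2 p.1 p.2) :=
      hf.comp (measurable_traj_cons z.1.1 z.1.2)
    rw [lintegral_smul_measure, lintegral_map hf (measurable_traj_cons _ _),
      lintegral_prod _ hfc.aemeasurable, smul_eq_mul, ← Finset.mul_sum]
    congr 1
    have : ∀ r₀ : ℝ, Measurable fun τ : Traj S A₁ A₂ m => f (Traj.cons z.1.1 z.1.2 r₀ τ) :=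
      fun r₀ => hfc.comp (measurable_const.prodMk measurable_id)
    simp_rw [lintegral_pathLaw _ _ _ _ _ (this _)]
    have hm : ∀ x : (Fin (m + 1) → S) × (Fin m → A₁ × A₂), Measurable fun r₀ : ℝ =>
        ∫⁻ r, f (Traj.cons z.1.1 z.1.2 r₀ (x.1, x.2, r))
          ∂(Measure.pi fun j : Fin m => G.reward (x.1 j.castSucc) (x.2 j)) := fun x =>
      Measurable.lintegral_prod_right' (f := fun p : ℝ × (Fin m → ℝ) =>
        f (Traj.cons z.1.1 z.1.2 p.1 (x.1, x.2, p.2)))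
        (hfc.comp (measurable_fst.prodMk ((measurable_traj_mk x).comp measurable_snd)))
    rw [lintegral_finsetSum _ fun x _ => (hm x).const_mul _]
    exact Finset.sum_congr rfl fun x _ => lintegral_const_mul _ (hm x)
  simp_rw [key]
  let e : (S × (A₁ × A₂)) × ((Fin (m + 1) → S) × (Fin m → A₁ × A₂)) ≃
      (Fin (m + 2) → S) × (Fin (m + 1) → A₁ × A₂) :=
    (Equiv.prodProdProdComm _ _ _ _).trans
      ((Fin.consEquiv fun _ => S).prodCongr (Fin.consEquiv fun _ => A₁ × A₂))
  rw [← e.sum_comp, Fintype.sum_prod_type, Fintype.sum_prod_type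
    (f := fun z : (S × (A₁ × A₂)) × S => _)]
  refine Finset.sum_congr rfl fun z _ => ?_
  rw [Finset.sum_comm]
  refine Finset.sum_congr rfl fun x _ => ?_
  -- The second state occurs twice, as target of the first transition and as start of the tail; the
  -- point mass keeps only the term where the two agree.
  rw [Finset.sum_eq_single (x.1 0)]
  · have h1 : (e (z, x)).1 = Fin.cons z.1 x.1 := rfl
    have h2 : (e (z, x)).2 = Fin.cons z.2 x.2 := rfl
    have hfx : Measurable fun r => f (Fin.cons z.1 x.1, Fin.cons z.2 x.2, r) :=
      hf.comp (measurable_traj_mk (Fin.cons z.1 x.1, Fin.cons z.2 x.2))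
    rw [h1, h2, lintegral_pi_cons _ hfx,
      Fin.prod_univ_succ]
    simp only [Fin.cons_zero, Fin.castSucc_zero, Fin.cons_succ, ← Fin.succ_castSucc, PMF.pure_apply,
      Traj.cons, Fin.val_zero, Fin.val_succ, add_zero, if_true, one_mul,
      mul_assoc, add_assoc, add_comm 1]
  · intro s _ hs
    simp [PMF.pure_apply, hs.symm]
  · simp

end MarkovGame

namespace Traj

variable {S A₁ A₂ : Type*} {m : ℕ}

@[simp] theorem cons_rew_zero (s : S) (a : A₁ × A₂) (r : ℝ) (τ : Traj S A₁ A₂ m) :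
    (cons s a r τ).rew 0 = r := rfl

@[simp] theorem cons_rew_succ (s : S) (a : A₁ × A₂) (r : ℝ) (τ : Traj S A₁ A₂ m) (j : Fin m) :
    (cons s a r τ).rew j.succ = τ.rew j := rfl

@[simp] theorem cons_state_zero (s : S) (a : A₁ × A₂) (r : ℝ) (τ : Traj S A₁ A₂ m) :
    (cons s a r τ).state 0 = s := rfl

@[simp] theorem cons_state_succ (s : S) (a : A₁ × A₂) (r : ℝ) (τ : Traj S A₁ A₂ m)
    (j : Fin (m + 1)) : (cons s a r τ).state j.succ = τ.state j := rfl

@[simp] theorem cons_action_zero (s : S) (a : A₁ × A₂) (r : ℝ) (τ : Traj S A₁ A₂ m) :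
    (cons s a r τ).action 0 = a := rfl

@[simp] theorem cons_action_succ (s : S) (a : A₁ × A₂) (r : ℝ) (τ : Traj S A₁ A₂ m) (j : Fin m) :
    (cons s a r τ).action j.succ = τ.action j := rfl

theorem discountedReturn_cons (γ : ℝ) (s : S) (a : A₁ × A₂) (r : ℝ) (τ : Traj S A₁ A₂ m) :
    (cons s a r τ).discountedReturn γ = r + γ * τ.discountedReturn γ := by
  simp only [discountedReturn, Fin.sum_univ_succ, cons_rew_zero, cons_rew_succ, Fin.val_zero,
    pow_zero, one_mul, Fin.val_succ, pow_succ', Finset.mul_sum, mul_assoc]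

variable [MeasurableSpace S] [MeasurableSpace A₁] [MeasurableSpace A₂]

@[fun_prop]
theorem measurable_state (t : Fin (m + 1)) :
    Measurable fun τ : Traj S A₁ A₂ m => τ.state t := by
  unfold state; fun_prop

@[fun_prop]
theorem measurable_action (t : Fin m) : Measurable fun τ : Traj S A₁ A₂ m => τ.action t := by
  unfold action; fun_prop

@[fun_prop]
theorem measurable_rew (t : Fin m) : Measurable fun τ : Traj S A₁ A₂ m => τ.rew t := by
  unfold rew; fun_prop

@[fun_prop]
theorem measurable_hist (l : ℕ) (hl : l ≤ m) :
    Measurable (hist l hl : Traj S A₁ A₂ m → Hist S A₁ A₂ l) := by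
  unfold hist; fun_prop

end Traj

/-! ### The class of functions for which every integrability question is settled by bounded rewards
and finite state and action spaces. -/

/-- A measurable function of a trajectory that is bounded on the trajectories with rewards bounded
by `R`. -/
structure RewardBounded {S A₁ A₂ : Type*} [MeasurableSpace S] [MeasurableSpace A₁]
    [MeasurableSpace A₂] {m : ℕ} (R : ℝ) (F : Traj S A₁ A₂ m → ℝ) : Prop where
  measurable : Measurable F
  bounded : ∃ M : ℝ, ∀ τ : Traj S A₁ A₂ m, (∀ j, |τ.rew j| ≤ R) → |F τ| ≤ M

namespace RewardBounded

variable {S A₁ A₂ : Type*} [MeasurableSpace S] [MeasurableSpace A₁] [MeasurableSpace A₂] {m : ℕ}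
  {R : ℝ} {F F' : Traj S A₁ A₂ m → ℝ}

theorem const (c : ℝ) : RewardBounded R fun _ : Traj S A₁ A₂ m => c :=
  ⟨measurable_const, |c|, fun _ _ => le_rfl⟩

theorem rew (j : Fin m) : RewardBounded R fun τ : Traj S A₁ A₂ m => τ.rew j :=
  ⟨by fun_prop, R, fun _ h => h j⟩

theorem add (h : RewardBounded R F) (h' : RewardBounded R F') :
    RewardBounded R fun τ => F τ + F' τ := by
  obtain ⟨M, hM⟩ := h.bounded
  obtain ⟨M', hM'⟩ := h'.bounded
  exact ⟨h.measurable.add h'.measurable, M + M', fun τ hτ =>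
    (abs_add_le _ _).trans (add_le_add (hM τ hτ) (hM' τ hτ))⟩

theorem mul (h : RewardBounded R F) (h' : RewardBounded R F') :
    RewardBounded R fun τ => F τ * F' τ := by
  obtain ⟨M, hM⟩ := h.bounded
  obtain ⟨M', hM'⟩ := h'.bounded
  refine ⟨h.measurable.mul h'.measurable, M * M', fun τ hτ => ?_⟩
  rw [abs_mul]
  exact mul_le_mul (hM τ hτ) (hM' τ hτ) (abs_nonneg _) ((abs_nonneg _).trans (hM τ hτ))

theorem neg (h : RewardBounded R F) : RewardBounded R fun τ => -F τ := by
  simpa using (const (-1)).mul h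

theorem sub (h : RewardBounded R F) (h' : RewardBounded R F') :
    RewardBounded R fun τ => F τ - F' τ := by
  simpa [sub_eq_add_neg] using h.add h'.neg

theorem pow (h : RewardBounded R F) (n : ℕ) : RewardBounded R fun τ => F τ ^ n := by
  induction n with
  | zero => simpa using const 1
  | succ n ih => simpa only [pow_succ] using ih.mul h

theorem sum {ι : Type*} (s : Finset ι) {f : ι → Traj S A₁ A₂ m → ℝ}
    (h : ∀ i ∈ s, RewardBounded R (f i)) : RewardBounded R fun τ => ∑ i ∈ s, f i τ := by
  classical
  induction s using Finset.induction_on with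
  | empty => simpa using const 0
  | insert i s hi ih =>
    simp only [Finset.sum_insert hi]
    exact (h i (by simp)).add (ih fun j hj => h j (by simp [hj]))

/-- Inductions on the number of steps freeze the first step; the bound on `r` holds for almost every
reward, which is enough under the integral. -/
theorem cons {F : Traj S A₁ A₂ (m + 1) → ℝ} (h : RewardBounded R F) (s : S) (a : A₁ × A₂) {r : ℝ}
    (hr : |r| ≤ R) : RewardBounded R fun τ : Traj S A₁ A₂ m => F (Traj.cons s a r τ) := by
  obtain ⟨M, hM⟩ := h.bounded
  refine ⟨(h.measurable.comp (MarkovGame.measurable_traj_cons s a)).comp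
    (measurable_const.prodMk measurable_id), M, fun τ hτ => hM _ fun j => ?_⟩
  refine Fin.cases hr (fun j => hτ j) j

/-- Functions of an observable with finitely many values. -/
theorem comp_finite {X : Type*} [Finite X] [MeasurableSpace X] [MeasurableSingletonClass X]
    {o : Traj S A₁ A₂ m → X} (ho : Measurable o) (f : X → ℝ) :
    RewardBounded R fun τ => f (o τ) := by
  obtain ⟨M, hM⟩ := (Set.finite_range fun x => |f x|).bddAbove
  exact ⟨(measurable_of_finite f).comp ho, M, fun τ _ => hM ⟨o τ, rfl⟩⟩

theorem state [MeasurableSingletonClass S] [Finite S] (j : Fin (m + 1)) (f : S → ℝ) :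
    RewardBounded R fun τ : Traj S A₁ A₂ m => f (τ.state j) :=
  comp_finite (Traj.measurable_state j) f

section Finite

variable [MeasurableSingletonClass S] [MeasurableSingletonClass A₁] [MeasurableSingletonClass A₂]
  [Finite S] [Finite A₁] [Finite A₂]

theorem state_action (j : Fin m) (f : S → A₁ × A₂ → ℝ) :
    RewardBounded R fun τ : Traj S A₁ A₂ m => f (τ.state j.castSucc) (τ.action j) :=
  comp_finite ((Traj.measurable_state j.castSucc).prodMk (Traj.measurable_action j))
    fun x => f x.1 x.2

theorem hist (l : ℕ) (hl : l ≤ m) (f : Hist S A₁ A₂ l → ℝ) :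
    RewardBounded R fun τ : Traj S A₁ A₂ m => f (τ.hist l hl) :=
  comp_finite (Traj.measurable_hist l hl) f

end Finite

theorem discountedReturn (γ : ℝ) :
    RewardBounded R fun τ : Traj S A₁ A₂ m => τ.discountedReturn γ :=
  sum _ fun j _ => (const _).mul (rew j)

end RewardBounded

/-! ### Integration against the path law. -/

namespace MarkovGame

variable {S A₁ A₂ : Type*} [MeasurableSpace S] [MeasurableSpace A₁] [MeasurableSpace A₂]

theorem integrable_id_reward {S A₁ A₂ : Type*} {G : MarkovGame S A₁ A₂} {R : ℝ}
    (hR : ∀ (s : S) (a : A₁ × A₂), ∀ᵐ r ∂G.reward s a, |r| ≤ R) (s : S) (a : A₁ × A₂) :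
    Integrable (fun r => r) (G.reward s a) :=
  memLp_one_iff_integrable.1 (MemLp.of_bound measurable_id.aestronglyMeasurable R (hR s a))

variable [Fintype S] [Fintype A₁] [Fintype A₂]

instance isProbabilityMeasure_pathLaw (G : MarkovGame S A₁ A₂) (π : PolicyProfile S A₁ A₂)
    (t₀ m : ℕ) (p₀ : PMF S) : IsProbabilityMeasure (G.pathLaw π t₀ m p₀) := by
  induction m generalizing t₀ p₀ with
  | zero =>
    refine ⟨?_⟩
    rw [← lintegral_one, lintegral_pathLaw _ _ _ _ _ measurable_const]
    simp only [lintegral_const, measure_univ, mul_one, Finset.univ_eq_empty, Finset.prod_empty,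
      Fintype.sum_prod_type, Fintype.sum_unique]
    rw [← p₀.sum_coe_fintype]
    exact Fintype.sum_equiv (Equiv.funUnique (Fin 1) S) _ _ fun x => rfl
  | succ m ih =>
    have : ∀ z : (S × (A₁ × A₂)) × S, IsProbabilityMeasure
        (((G.reward z.1.1 z.1.2).prod (G.pathLaw π (t₀ + 1) m (PMF.pure z.2))).map
          fun p => Traj.cons z.1.1 z.1.2 p.1 p.2) := fun z =>
      Measure.isProbabilityMeasure_map (measurable_traj_cons _ _).aemeasurable
    refine ⟨?_⟩
    rw [pathLaw_succ, Measure.finsetSum_apply]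
    simp only [Measure.smul_apply, measure_univ, smul_eq_mul, mul_one, Fintype.sum_prod_type,
      ← Finset.mul_sum, PMF.sum_coe_fintype]
    simp [← Fintype.sum_prod_type', PolicyProfile.sum_prob, PMF.sum_coe_fintype]

instance isProbabilityMeasure_law (G : MarkovGame S A₁ A₂) (π : PolicyProfile S A₁ A₂) :
    IsProbabilityMeasure (G.law π) :=
  G.isProbabilityMeasure_pathLaw _ _ _ _

theorem ae_abs_rew_le (G : MarkovGame S A₁ A₂) {R : ℝ}
    (hR : ∀ (s : S) (a : A₁ × A₂), ∀ᵐ r ∂G.reward s a, |r| ≤ R) (π : PolicyProfile S A₁ A₂)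
    (t₀ m : ℕ) (p₀ : PMF S) : ∀ᵐ τ ∂G.pathLaw π t₀ m p₀, ∀ j, |τ.rew j| ≤ R := by
  rw [pathLaw, ae_finsetSum_measure_iff]
  intro x _
  refine Measure.ae_smul_measure ?_ _
  refine (ae_map_iff (measurable_traj_mk x).aemeasurable ?_).2 ?_
  · simp only [Set.ofPred_forall]
    exact MeasurableSet.iInter fun j =>
      measurableSet_le (Traj.measurable_rew j).abs measurable_const
  · exact ae_all_iff.2 fun j =>
      (measurePreserving_eval (fun j : Fin m => G.reward (x.1 j.castSucc) (x.2 j)) j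
        |>.quasiMeasurePreserving.ae (hR _ _))

theorem _root_.RewardBounded.memLp {G : MarkovGame S A₁ A₂} {R : ℝ}
    (hR : ∀ (s : S) (a : A₁ × A₂), ∀ᵐ r ∂G.reward s a, |r| ≤ R) {π : PolicyProfile S A₁ A₂}
    {t₀ m : ℕ} {p₀ : PMF S} {F : Traj S A₁ A₂ m → ℝ} (hF : RewardBounded R F) (p : ℝ≥0∞) :
    MemLp F p (G.pathLaw π t₀ m p₀) := by
  obtain ⟨M, hM⟩ := hF.bounded
  refine MemLp.of_bound hF.measurable.aestronglyMeasurable M ?_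
  filter_upwards [G.ae_abs_rew_le hR π t₀ m p₀] with τ hτ using hM τ hτ

theorem _root_.RewardBounded.integrable {G : MarkovGame S A₁ A₂} {R : ℝ}
    (hR : ∀ (s : S) (a : A₁ × A₂), ∀ᵐ r ∂G.reward s a, |r| ≤ R) {π : PolicyProfile S A₁ A₂}
    {t₀ m : ℕ} {p₀ : PMF S} {F : Traj S A₁ A₂ m → ℝ} (hF : RewardBounded R F) :
    Integrable F (G.pathLaw π t₀ m p₀) :=
  memLp_one_iff_integrable.1 (hF.memLp hR 1)

/-- Integration over a trajectory, the first step separately. -/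
theorem integral_pathLaw_succ {G : MarkovGame S A₁ A₂} {R : ℝ}
    (hR : ∀ (s : S) (a : A₁ × A₂), ∀ᵐ r ∂G.reward s a, |r| ≤ R) (π : PolicyProfile S A₁ A₂)
    (t₀ m : ℕ) (p₀ : PMF S) {F : Traj S A₁ A₂ (m + 1) → ℝ} (hF : RewardBounded R F) :
    ∫ τ, F τ ∂G.pathLaw π t₀ (m + 1) p₀ = ∑ s, (p₀ s).toReal * ∑ a, (π.prob t₀ s a).toReal *
      ∑ s', (G.trans s a s').toReal *
        ∫ r, ∫ τ, F (Traj.cons s a r τ) ∂G.pathLaw π (t₀ + 1) m (PMF.pure s') ∂G.reward s a := by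
  have hint : ∀ z : (S × (A₁ × A₂)) × S, Integrable
      (fun p : ℝ × Traj S A₁ A₂ m => F (Traj.cons z.1.1 z.1.2 p.1 p.2))
      ((G.reward z.1.1 z.1.2).prod (G.pathLaw π (t₀ + 1) m (PMF.pure z.2))) := by
    intro z
    obtain ⟨M, hM⟩ := hF.bounded
    refine Integrable.of_bound
      (hF.measurable.comp (measurable_traj_cons _ _)).aestronglyMeasurable M ?_
    have h1 : ∀ᵐ p ∂(G.reward z.1.1 z.1.2).prod (G.pathLaw π (t₀ + 1) m (PMF.pure z.2)),
        |p.1| ≤ R := Measure.quasiMeasurePreserving_fst.ae (hR _ _)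
    have h2 : ∀ᵐ p ∂(G.reward z.1.1 z.1.2).prod (G.pathLaw π (t₀ + 1) m (PMF.pure z.2)),
        ∀ j, |p.2.rew j| ≤ R := Measure.quasiMeasurePreserving_snd.ae (G.ae_abs_rew_le hR _ _ _ _)
    filter_upwards [h1, h2] with p hp1 hp2
    exact hM _ fun j => Fin.cases hp1 (fun j => hp2 j) j
  have hmap : ∀ z : (S × (A₁ × A₂)) × S, Integrable F
      (((G.reward z.1.1 z.1.2).prod (G.pathLaw π (t₀ + 1) m (PMF.pure z.2))).map
        fun p => Traj.cons z.1.1 z.1.2 p.1 p.2) := fun z =>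
    (integrable_map_measure hF.measurable.aestronglyMeasurable
      (measurable_traj_cons _ _).aemeasurable).2 (hint z)
  rw [pathLaw_succ, integral_finsetSum_measure fun z _ => (hmap z).smul_measure
    (ENNReal.mul_ne_top (ENNReal.mul_ne_top (PMF.apply_ne_top _ _) (π.prob_ne_top _ _ _))
      (PMF.apply_ne_top _ _))]
  simp only [integral_smul_measure, Fintype.sum_prod_type (f := fun z : (S × (A₁ × A₂)) × S => _),
    Fintype.sum_prod_type (f := fun z : S × (A₁ × A₂) => _), Finset.mul_sum]
  refine Finset.sum_congr rfl fun s _ => Finset.sum_congr rfl fun a _ =>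
    Finset.sum_congr rfl fun s' _ => ?_
  rw [integral_map (measurable_traj_cons _ _).aemeasurable hF.measurable.aestronglyMeasurable,
    integral_prod _ (hint ((s, a), s')), ENNReal.toReal_mul, ENNReal.toReal_mul, smul_eq_mul]
  ring

/-- The initial weight of a path is linear in `p₀`. This reduces integrals to a known first state,
and so expresses the value through `stateValue`. -/
theorem pathLaw_eq_sum_pure (G : MarkovGame S A₁ A₂) (π : PolicyProfile S A₁ A₂)
    (t₀ m : ℕ) (p₀ : PMF S) :
    G.pathLaw π t₀ m p₀ = ∑ s, p₀ s • G.pathLaw π t₀ m (PMF.pure s) := by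
  classical
  simp only [pathLaw, Finset.smul_sum]
  rw [Finset.sum_comm]
  refine Finset.sum_congr rfl fun x _ => ?_
  rw [Finset.sum_eq_single (x.1 0)]
  · simp [smul_smul]
  · intro s _ hs
    simp [PMF.pure_apply, hs.symm]
  · simp

theorem ae_state_zero_eq [MeasurableSingletonClass S] (G : MarkovGame S A₁ A₂)
    (π : PolicyProfile S A₁ A₂) (t₀ m : ℕ) (s : S) :
    ∀ᵐ τ ∂G.pathLaw π t₀ m (PMF.pure s), τ.state 0 = s := by
  classical
  rw [pathLaw, ae_finsetSum_measure_iff]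
  intro x _
  by_cases hx : x.1 0 = s
  · refine Measure.ae_smul_measure ?_ _
    refine (ae_map_iff (measurable_traj_mk x).aemeasurable ?_).2 (ae_of_all _ fun r => hx)
    exact Traj.measurable_state 0 (measurableSet_singleton s)
  · simp [PMF.pure_apply, hx]

theorem integral_pathLaw_eq_sum {G : MarkovGame S A₁ A₂} {R : ℝ}
    (hR : ∀ (s : S) (a : A₁ × A₂), ∀ᵐ r ∂G.reward s a, |r| ≤ R) (π : PolicyProfile S A₁ A₂)
    (t₀ m : ℕ) (p₀ : PMF S) {F : Traj S A₁ A₂ m → ℝ} (hF : RewardBounded R F) :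
    ∫ τ, F τ ∂G.pathLaw π t₀ m p₀ =
      ∑ s, (p₀ s).toReal * ∫ τ, F τ ∂G.pathLaw π t₀ m (PMF.pure s) := by
  rw [pathLaw_eq_sum_pure, integral_finsetSum_measure fun s _ =>
    (hF.integrable hR).smul_measure (PMF.apply_ne_top _ _)]
  simp [integral_smul_measure]

theorem integral_state_zero [MeasurableSingletonClass S] (G : MarkovGame S A₁ A₂) {R : ℝ}
    (hR : ∀ (s : S) (a : A₁ × A₂), ∀ᵐ r ∂G.reward s a, |r| ≤ R) (π : PolicyProfile S A₁ A₂)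
    (t₀ m : ℕ) (p₀ : PMF S) (g : S → ℝ) :
    ∫ τ, g (τ.state 0) ∂G.pathLaw π t₀ m p₀ = ∑ s, (p₀ s).toReal * g s := by
  rw [integral_pathLaw_eq_sum hR _ _ _ _ (RewardBounded.comp_finite (Traj.measurable_state 0) g)]
  refine Finset.sum_congr rfl fun s _ => ?_
  rw [integral_congr_ae (g := fun _ => g s)]
  · simp
  · filter_upwards [G.ae_state_zero_eq π t₀ m s] with τ hτ
    simp [hτ]

end MarkovGame

/-! ### Functions of the past, the Bellman equation, and the two residual identities. -/

/-- The function depends only on what precedes the reward of step `j`. -/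
def PrecedesReward {S A₁ A₂ : Type*} {m : ℕ} (j : Fin m) (H : Traj S A₁ A₂ m → ℝ) : Prop :=
  ∀ τ τ' : Traj S A₁ A₂ m, (∀ i ≤ j.castSucc, τ.state i = τ'.state i) →
    (∀ i ≤ j, τ.action i = τ'.action i) → (∀ i < j, τ.rew i = τ'.rew i) → H τ = H τ'

/-- The function depends only on what precedes the action of step `j`. -/
def PrecedesAction {S A₁ A₂ : Type*} {m : ℕ} (j : Fin m) (H : Traj S A₁ A₂ m → ℝ) : Prop :=
  ∀ τ τ' : Traj S A₁ A₂ m, (∀ i ≤ j.castSucc, τ.state i = τ'.state i) →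
    (∀ i < j, τ.action i = τ'.action i) → (∀ i < j, τ.rew i = τ'.rew i) → H τ = H τ'

section Precedes

variable {S A₁ A₂ : Type*} {m : ℕ}

/-- Dependence on the past survives freezing the first step: the induction step of the residual
identities. -/
theorem PrecedesReward.cons {j : Fin m} {H : Traj S A₁ A₂ (m + 1) → ℝ}
    (h : PrecedesReward j.succ H) (s : S) (a : A₁ × A₂) (r : ℝ) :
    PrecedesReward j fun τ => H (Traj.cons s a r τ) := by
  intro τ τ' hs ha hr
  refine h _ _ (fun i => ?_) (fun i => ?_) (fun i => ?_)
  · refine Fin.cases (fun _ => rfl) (fun i hi => hs i ?_) i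
    rwa [← Fin.succ_castSucc, Fin.succ_le_succ_iff] at hi
  · exact Fin.cases (fun _ => rfl) (fun i hi => ha i (Fin.succ_le_succ_iff.1 hi)) i
  · exact Fin.cases (fun _ => rfl) (fun i hi => hr i (Fin.succ_lt_succ_iff.1 hi)) i

theorem PrecedesAction.cons {j : Fin m} {H : Traj S A₁ A₂ (m + 1) → ℝ}
    (h : PrecedesAction j.succ H) (s : S) (a : A₁ × A₂) (r : ℝ) :
    PrecedesAction j fun τ => H (Traj.cons s a r τ) := by
  intro τ τ' hs ha hr
  refine h _ _ (fun i => ?_) (fun i => ?_) (fun i => ?_)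
  · refine Fin.cases (fun _ => rfl) (fun i hi => hs i ?_) i
    rwa [← Fin.succ_castSucc, Fin.succ_le_succ_iff] at hi
  · exact Fin.cases (fun _ => rfl) (fun i hi => ha i (Fin.succ_lt_succ_iff.1 hi)) i
  · exact Fin.cases (fun _ => rfl) (fun i hi => hr i (Fin.succ_lt_succ_iff.1 hi)) i

/-- The base case of the residual identities: at step `0` the past is the pair `(s, a)`, so `H`
factors out of the remaining integrals. -/
theorem PrecedesReward.exists_eq_cons {H : Traj S A₁ A₂ (m + 1) → ℝ} (h : PrecedesReward 0 H)
    (s : S) (a : A₁ × A₂) : ∃ c, ∀ r τ, H (Traj.cons s a r τ) = c := by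
  refine ⟨H (fun _ => s, fun _ => a, fun _ => 0), fun r τ => h _ _ ?_ ?_ ?_⟩
  · intro i hi
    obtain rfl : i = 0 := nonpos_iff_eq_zero.1 hi
    rfl
  · intro i hi
    obtain rfl : i = 0 := nonpos_iff_eq_zero.1 hi
    rfl
  · intro i hi
    exact absurd hi (Fin.not_lt_zero i)

theorem PrecedesAction.exists_eq_cons {H : Traj S A₁ A₂ (m + 1) → ℝ} (h : PrecedesAction 0 H)
    (s : S) : ∃ c, ∀ a r τ, H (Traj.cons s a r τ) = c := by
  -- The reference trajectory needs some action as filler; without actions the claim is vacuous.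
  by_cases hne : Nonempty (A₁ × A₂)
  · obtain ⟨a₀⟩ := hne
    refine ⟨H (fun _ => s, fun _ => a₀, fun _ => 0), fun a r τ => h _ _ ?_ ?_ ?_⟩
    · intro i hi
      obtain rfl : i = 0 := nonpos_iff_eq_zero.1 hi
      rfl
    · intro i hi
      exact absurd hi (Fin.not_lt_zero i)
    · intro i hi
      exact absurd hi (Fin.not_lt_zero i)
  · exact ⟨0, fun a => (hne ⟨a⟩).elim⟩

end Precedes

namespace MarkovGame

variable {S A₁ A₂ : Type*} [MeasurableSpace S] [MeasurableSpace A₁] [MeasurableSpace A₂]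
  [Fintype S] [Fintype A₁] [Fintype A₂] {G : MarkovGame S A₁ A₂} {R : ℝ}

theorem stateValue_horizon (π : PolicyProfile S A₁ A₂) (s : S) :
    G.stateValue π G.horizon s = 0 := by
  unfold stateValue
  -- The number of remaining steps occurs in the type of the trajectories, so it is generalized
  -- before being replaced by zero.
  generalize hm : G.horizon - G.horizon = m
  obtain rfl : m = 0 := by omega
  simp [Traj.discountedReturn]

/-- The Bellman equation. -/
theorem stateValue_eq_sum_qValue
    (hR : ∀ (s : S) (a : A₁ × A₂), ∀ᵐ r ∂G.reward s a, |r| ≤ R) (π : PolicyProfile S A₁ A₂)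
    {t : ℕ} (ht : t < G.horizon) (s : S) :
    G.stateValue π t s = ∑ a, (π.prob t s a).toReal * G.qValue π t s a := by
  classical
  have hm : G.horizon - t = G.horizon - (t + 1) + 1 := by omega
  rw [stateValue, hm, integral_pathLaw_succ hR _ _ _ _ (RewardBounded.discountedReturn G.γ),
    Finset.sum_eq_single s]
  · simp only [PMF.pure_apply, if_true, ENNReal.toReal_one, one_mul]
    refine Finset.sum_congr rfl fun a _ => ?_
    congr 1
    have : ∀ s', ∫ r, ∫ τ, (Traj.cons s a r τ).discountedReturn G.γ
        ∂G.pathLaw π (t + 1) (G.horizon - (t + 1)) (PMF.pure s') ∂G.reward s a =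
        G.meanReward s a + G.γ * G.stateValue π (t + 1) s' := by
      intro s'
      simp_rw [Traj.discountedReturn_cons]
      have h1 : ∀ r : ℝ, ∫ τ, (r + G.γ * τ.discountedReturn G.γ)
          ∂G.pathLaw π (t + 1) (G.horizon - (t + 1)) (PMF.pure s') =
          r + G.γ * G.stateValue π (t + 1) s' := by
        intro r
        rw [integral_add (integrable_const _)
          (((RewardBounded.discountedReturn G.γ).integrable hR).const_mul _), integral_const_mul]
        simp [stateValue]
      simp_rw [h1]
      rw [integral_add (integrable_id_reward hR s a) (integrable_const _)]
      simp [meanReward]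
    simp_rw [this, mul_add, Finset.sum_add_distrib, ← Finset.sum_mul, PMF.sum_toReal, one_mul]
    rfl
  · intro s' _ hs
    simp [PMF.pure_apply, hs]
  · simp

theorem value₁_eq_sum_stateValue
    (hR : ∀ (s : S) (a : A₁ × A₂), ∀ᵐ r ∂G.reward s a, |r| ≤ R) (π : PolicyProfile S A₁ A₂) :
    G.value₁ π = ∑ s, (G.init s).toReal * G.stateValue π 0 s :=
  integral_pathLaw_eq_sum hR π 0 G.horizon G.init (RewardBounded.discountedReturn G.γ)

variable [MeasurableSingletonClass S] [MeasurableSingletonClass A₁] [MeasurableSingletonClass A₂]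

/-- The reward and the next state average out given what precedes them. -/
theorem integral_mul_reward_residual
    (hR : ∀ (s : S) (a : A₁ × A₂), ∀ᵐ r ∂G.reward s a, |r| ≤ R) (π : PolicyProfile S A₁ A₂)
    (t₀ m : ℕ) (p₀ : PMF S) (j : Fin m) (c : S → ℝ) {H : Traj S A₁ A₂ m → ℝ}
    (hH : RewardBounded R H) (hpre : PrecedesReward j H) :
    ∫ τ, H τ * (τ.rew j + c (τ.state j.succ) -
      (G.meanReward (τ.state j.castSucc) (τ.action j) +
        ∑ s', (G.trans (τ.state j.castSucc) (τ.action j) s').toReal * c s'))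
      ∂G.pathLaw π t₀ m p₀ = 0 := by
  induction m generalizing t₀ p₀ with
  | zero => exact j.elim0
  | succ m ih =>
    rw [integral_pathLaw_succ hR]
    swap
    · exact hH.mul (((RewardBounded.rew j).add (.state _ c)).sub
        (.state_action j fun s a => G.meanReward s a + ∑ s', (G.trans s a s').toReal * c s'))
    refine Finset.sum_eq_zero fun s _ => mul_eq_zero_of_right _ <|
      Finset.sum_eq_zero fun a _ => mul_eq_zero_of_right _ ?_
    -- If `j` is the first step, only the average over the next state vanishes. For a later step the
    -- integral vanishes for each next state and almost every first reward, by the induction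
    -- hypothesis for the tail.
    induction j using Fin.cases with
    | zero =>
      obtain ⟨h, hh⟩ := hpre.exists_eq_cons s a
      set K := G.meanReward s a + ∑ s', (G.trans s a s').toReal * c s' with hK
      have inner : ∀ s' : S, ∫ r, ∫ τ, H (Traj.cons s a r τ) *
          ((Traj.cons s a r τ).rew 0 + c ((Traj.cons s a r τ).state (Fin.succ 0)) -
          (G.meanReward ((Traj.cons s a r τ).state (Fin.castSucc 0)) ((Traj.cons s a r τ).action 0) +
            ∑ s', (G.trans ((Traj.cons s a r τ).state (Fin.castSucc 0))
              ((Traj.cons s a r τ).action 0) s').toReal * c s'))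
          ∂G.pathLaw π (t₀ + 1) m (PMF.pure s') ∂G.reward s a =
          h * (G.meanReward s a + c s' - K) := by
        intro s'
        have : ∀ r : ℝ, ∫ τ, H (Traj.cons s a r τ) *
          ((Traj.cons s a r τ).rew 0 + c ((Traj.cons s a r τ).state (Fin.succ 0)) -
          (G.meanReward ((Traj.cons s a r τ).state (Fin.castSucc 0)) ((Traj.cons s a r τ).action 0) +
            ∑ s', (G.trans ((Traj.cons s a r τ).state (Fin.castSucc 0))
              ((Traj.cons s a r τ).action 0) s').toReal * c s'))
          ∂G.pathLaw π (t₀ + 1) m (PMF.pure s') = h * (r + (c s' - K)) := by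
          intro r
          rw [integral_congr_ae (g := fun _ => h * (r + (c s' - K)))]
          · simp
          · filter_upwards [G.ae_state_zero_eq π (t₀ + 1) m s'] with τ hτ
            simp only [hh, Traj.cons_rew_zero, Traj.cons_state_succ, hτ, Fin.castSucc_zero,
              Traj.cons_state_zero, Traj.cons_action_zero, ← hK]
            ring
        simp_rw [this]
        rw [integral_const_mul, integral_add (integrable_id_reward hR s a) (integrable_const _),
          integral_const, meanReward, probReal_univ, one_smul]
        ring
      simp_rw [inner]
      have : ∀ s', (G.trans s a s').toReal * (h * (G.meanReward s a + c s' - K)) =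
          h * ((G.trans s a s').toReal * c s') +
            (G.trans s a s').toReal * (h * (G.meanReward s a - K)) := fun s' => by ring
      simp_rw [this]
      rw [Finset.sum_add_distrib, ← Finset.mul_sum, ← Finset.sum_mul, PMF.sum_toReal, hK]
      ring
    | succ j =>
      refine Finset.sum_eq_zero fun s' _ => mul_eq_zero_of_right _ ?_
      rw [integral_congr_ae (g := fun _ => 0), integral_zero]
      filter_upwards [hR s a] with r hr
      exact ih (t₀ + 1) (PMF.pure s') j (hH.cons s a hr) (hpre.cons s a r)

/-- The action averages out given what precedes it. -/
theorem integral_mul_action_residual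
    (hR : ∀ (s : S) (a : A₁ × A₂), ∀ᵐ r ∂G.reward s a, |r| ≤ R) (π : PolicyProfile S A₁ A₂)
    (t₀ m : ℕ) (p₀ : PMF S) (j : Fin m) (g : S → A₁ × A₂ → ℝ) {H : Traj S A₁ A₂ m → ℝ}
    (hH : RewardBounded R H) (hpre : PrecedesAction j H) :
    ∫ τ, H τ * (g (τ.state j.castSucc) (τ.action j) -
      ∑ a, (π.prob (t₀ + j) (τ.state j.castSucc) a).toReal * g (τ.state j.castSucc) a)
      ∂G.pathLaw π t₀ m p₀ = 0 := by
  induction m generalizing t₀ p₀ with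
  | zero => exact j.elim0
  | succ m ih =>
    rw [integral_pathLaw_succ hR]
    swap
    · exact hH.mul ((RewardBounded.state_action j g).sub
        (.state j.castSucc fun s => ∑ a, (π.prob (t₀ + j) s a).toReal * g s a))
    refine Finset.sum_eq_zero fun s _ => mul_eq_zero_of_right _ ?_
    -- If `j` is the first step, reward, next state and tail integrate to one and the average over
    -- the action cancels; otherwise the induction hypothesis applies to the tail.
    induction j using Fin.cases with
    | zero =>
      obtain ⟨h, hh⟩ := hpre.exists_eq_cons s
      simp only [hh, Fin.castSucc_zero, Traj.cons_state_zero, Traj.cons_action_zero, Fin.val_zero,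
        add_zero, integral_const, probReal_univ, one_smul, ← Finset.sum_mul, PMF.sum_toReal,
        one_mul]
      simp only [mul_left_comm _ h, ← Finset.mul_sum, mul_sub, Finset.sum_sub_distrib,
        ← Finset.sum_mul, PolicyProfile.sum_prob_toReal, one_mul, sub_self]
    | succ j =>
      refine Finset.sum_eq_zero fun a _ => mul_eq_zero_of_right _ <|
        Finset.sum_eq_zero fun s' _ => mul_eq_zero_of_right _ ?_
      rw [integral_congr_ae (g := fun _ => 0), integral_zero]
      filter_upwards [hR s a] with r hr
      have := ih (t₀ + 1) (PMF.pure s') j (hH.cons s a hr) (hpre.cons s a r)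
      have e : t₀ + 1 + (j : ℕ) = t₀ + ((j.succ : Fin (m + 1)) : ℕ) := by
        rw [Fin.val_succ]; ring
      rw [e] at this
      exact this

end MarkovGame

/-! ### The score with the true state-action values: mean and variance. -/

section Precedes

variable {S A₁ A₂ : Type*} {m : ℕ}

/-- The history of `t + 1` steps ends with the action of step `t`, hence precedes the reward of that
step; the history of `t` steps does not yet contain the state or action of step `t`. -/
theorem precedesReward_hist (t : Fin m) (f : Hist S A₁ A₂ ((t : ℕ) + 1) → ℝ) :
    PrecedesReward t fun τ => f (τ.hist ((t : ℕ) + 1) t.2) := by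
  intro τ τ' hs ha _
  have : τ.hist ((t : ℕ) + 1) t.2 = τ'.hist ((t : ℕ) + 1) t.2 := by
    funext i
    have hi : (i : ℕ) ≤ t := Nat.lt_succ_iff.1 i.2
    exact Prod.ext (hs _ (by simpa [Fin.le_def] using hi)) (ha _ (by simpa [Fin.le_def] using hi))
  simp only [this]

theorem precedesAction_hist (t : Fin m) (f : Hist S A₁ A₂ t → ℝ) :
    PrecedesAction t fun τ => f (τ.hist t t.2.le) := by
  intro τ τ' hs ha _
  have : τ.hist t t.2.le = τ'.hist t t.2.le := by
    funext i
    exact Prod.ext (hs _ (by simp [Fin.le_def]))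
      (ha _ (by simp [Fin.lt_def]))
  simp only [this]

end Precedes

theorem cumRatio_hist_succ {S A₁ A₂ : Type*} {m : ℕ} (π πb : PolicyProfile S A₁ A₂) (t : Fin m)
    (τ : Traj S A₁ A₂ m) :
    cumRatio π πb ((t : ℕ) + 1) (τ.hist ((t : ℕ) + 1) t.2) =
      cumRatio π πb t (τ.hist t t.2.le) *
        densityRatio π πb t (τ.state t.castSucc) (τ.action t) := by
  rw [cumRatio, Fin.prod_univ_castSucc]
  rfl

namespace MarkovGame

variable {S A₁ A₂ : Type*} [MeasurableSpace S] [MeasurableSpace A₁] [MeasurableSpace A₂]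
  [Fintype S] [Fintype A₁] [Fintype A₂] {G : MarkovGame S A₁ A₂} {R : ℝ}

/-- The temporal difference `r_t + γ V_{t+1}(s_{t+1}) - Q_t(s_t, a_t)`. -/
noncomputable def tdResidual (G : MarkovGame S A₁ A₂) (π : PolicyProfile S A₁ A₂)
    (t : Fin G.horizon) (τ : Traj S A₁ A₂ G.horizon) : ℝ :=
  τ.rew t + G.γ * G.stateValue π (t + 1) (τ.state t.succ) -
    G.qValue π t (τ.state t.castSucc) (τ.action t)

theorem precedesReward_tdResidual (π : PolicyProfile S A₁ A₂) {u t : Fin G.horizon} (h : u < t) :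
    PrecedesReward t fun τ => G.tdResidual π u τ := by
  intro τ τ' hs ha hr
  have h1 := hs u.castSucc (by simpa using h.le)
  have h2 := hs u.succ (Fin.succ_le_castSucc_iff.2 h)
  simp only [tdResidual, h1, h2, ha u h.le, hr u h]

/-- With the true state-action values, the score is the state value plus temporal differences. -/
theorem drScore_qValue_eq (hR : ∀ (s : S) (a : A₁ × A₂), ∀ᵐ r ∂G.reward s a, |r| ≤ R)
    (π : PolicyProfile S A₁ A₂) {w : (l : ℕ) → Hist S A₁ A₂ l → ℝ} (hw : ∀ h, w 0 h = 1)
    (τ : Traj S A₁ A₂ G.horizon) :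
    G.drScore π (fun t => G.qValue π t) w τ = G.stateValue π 0 (τ.state 0) +
      ∑ t : Fin G.horizon, G.γ ^ (t : ℕ) *
        (w (t + 1) (τ.hist (t + 1) t.2) * G.tdResidual π t τ) := by
  -- The discounted weighted state values telescope between `k = 0`, where the weight is `1`, and
  -- the horizon, where the value vanishes. The default value beyond the horizon is never met.
  let u : ℕ → ℝ := fun k => if h : k ≤ G.horizon then
    G.γ ^ k * (w k (τ.hist k h) * G.stateValue π k (τ.state ⟨k, Nat.lt_succ_of_le h⟩)) else 0
  have hu0 : u 0 = G.stateValue π 0 (τ.state 0) := by simp [u, hw]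
  have huT : u G.horizon = 0 := by simp [u, stateValue_horizon]
  have tele : ∑ t : Fin G.horizon, (u (t + 1) - u t) = u G.horizon - u 0 := by
    rw [Fin.sum_univ_eq_sum_range (fun t => u (t + 1) - u t), Finset.sum_range_sub]
  rw [huT, hu0, zero_sub] at tele
  have hV : G.stateValue π 0 (τ.state 0) = -∑ t : Fin G.horizon, (u (t + 1) - u t) := by
    rw [tele, neg_neg]
  rw [hV, drScore, ← Finset.sum_neg_distrib, ← Finset.sum_add_distrib]
  refine Finset.sum_congr rfl fun t _ => ?_
  have hut : u t = G.γ ^ (t : ℕ) * (w t (τ.hist t t.2.le) *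
      G.stateValue π t (τ.state t.castSucc)) := dif_pos t.2.le
  have hut' : u (t + 1) = G.γ ^ ((t : ℕ) + 1) * (w (t + 1) (τ.hist (t + 1) t.2) *
      G.stateValue π (t + 1) (τ.state t.succ)) := dif_pos t.2
  rw [hut, hut', tdResidual, stateValue_eq_sum_qValue hR π t.2]
  ring

variable [MeasurableSingletonClass S]

/-- Only the first state enters, and its law is `G.init` under every profile; this is why the
behavior law yields the value of the target profile. -/
theorem integral_stateValue_zero (hR : ∀ (s : S) (a : A₁ × A₂), ∀ᵐ r ∂G.reward s a, |r| ≤ R)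
    (π πb : PolicyProfile S A₁ A₂) :
    ∫ τ, G.stateValue π 0 (τ.state 0) ∂G.law πb = G.value₁ π := by
  rw [law, integral_state_zero G hR, value₁_eq_sum_stateValue hR]

variable [MeasurableSingletonClass A₁] [MeasurableSingletonClass A₂]

theorem rewardBounded_tdResidual (π : PolicyProfile S A₁ A₂) (t : Fin G.horizon) :
    RewardBounded R fun τ => G.tdResidual π t τ :=
  ((RewardBounded.rew t).add ((RewardBounded.const _).mul (.state _ _))).sub (.state_action t _)

theorem rewardBounded_drScore (π : PolicyProfile S A₁ A₂)
    (q : Fin G.horizon → S → A₁ × A₂ → ℝ) (w : (l : ℕ) → Hist S A₁ A₂ l → ℝ) :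
    RewardBounded R fun τ => G.drScore π q w τ :=
  .sum _ fun t _ => (RewardBounded.const _).mul <|
    ((RewardBounded.hist _ _ (w (t + 1))).mul ((RewardBounded.rew t).sub (.state_action t (q t)))).add
      ((RewardBounded.hist _ _ (w t)).mul
        (.state t.castSucc fun s => ∑ a, (π.prob t s a).toReal * q t s a))

theorem integral_mul_tdResidual (hR : ∀ (s : S) (a : A₁ × A₂), ∀ᵐ r ∂G.reward s a, |r| ≤ R)
    (π πb : PolicyProfile S A₁ A₂) (t : Fin G.horizon) {H : Traj S A₁ A₂ G.horizon → ℝ}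
    (hH : RewardBounded R H) (hpre : PrecedesReward t H) :
    ∫ τ, H τ * G.tdResidual π t τ ∂G.law πb = 0 :=
  integral_mul_reward_residual hR πb 0 G.horizon G.init t
    (fun s => G.γ * G.stateValue π (t + 1) s) hH hpre

/-- With the true state-action values the score is unbiased. -/
theorem integral_drScore_qValue (hR : ∀ (s : S) (a : A₁ × A₂), ∀ᵐ r ∂G.reward s a, |r| ≤ R)
    (π πb : PolicyProfile S A₁ A₂) {w : (l : ℕ) → Hist S A₁ A₂ l → ℝ} (hw : ∀ h, w 0 h = 1) :
    ∫ τ, G.drScore π (fun t => G.qValue π t) w τ ∂G.law πb = G.value₁ π := by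
  simp_rw [drScore_qValue_eq hR π hw]
  have hb : ∀ t : Fin G.horizon, RewardBounded R fun τ : Traj S A₁ A₂ G.horizon =>
      w (t + 1) (τ.hist (t + 1) t.2) * G.tdResidual π t τ := fun t =>
    (RewardBounded.hist _ _ (w (t + 1))).mul (rewardBounded_tdResidual π t)
  rw [law, integral_add ((RewardBounded.state 0 _).integrable hR)
    ((RewardBounded.sum _ fun t _ => (RewardBounded.const _).mul (hb t)).integrable hR),
    integral_finsetSum _ fun t _ => ((RewardBounded.const _).mul (hb t)).integrable hR, ← law,
    integral_stateValue_zero hR]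
  simp_rw [integral_const_mul]
  rw [Finset.sum_eq_zero fun t _ => ?_, add_zero]
  rw [integral_mul_tdResidual hR π πb t (.hist _ _ (w (t + 1))) (precedesReward_hist t _), mul_zero]

/-- The defining set integrals are integrals against indicators of history events. These precede the
reward of step `t`, so the temporal difference integrates to zero against them. -/
theorem condExp_reward_add_stateValue
    (hR : ∀ (s : S) (a : A₁ × A₂), ∀ᵐ r ∂G.reward s a, |r| ≤ R)
    (π πb : PolicyProfile S A₁ A₂) (t : Fin G.horizon) :
    (G.law πb)[fun τ => τ.rew t + G.γ * G.stateValue π (t + 1) (τ.state t.succ) |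
      MeasurableSpace.comap (Traj.hist ((t : ℕ) + 1) t.2) inferInstance] =ᵐ[G.law πb]
      fun τ => G.qValue π t (τ.state t.castSucc) (τ.action t) := by
  have hm : MeasurableSpace.comap (Traj.hist (S := S) (A₁ := A₁) (A₂ := A₂) ((t : ℕ) + 1) t.2)
      inferInstance ≤ (inferInstance : MeasurableSpace (Traj S A₁ A₂ G.horizon)) :=
    (Traj.measurable_hist _ _).comap_le
  have hZ : RewardBounded R fun τ : Traj S A₁ A₂ G.horizon =>
      τ.rew t + G.γ * G.stateValue π (t + 1) (τ.state t.succ) :=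
    (RewardBounded.rew t).add ((RewardBounded.const _).mul (.state _ _))
  have hQ : RewardBounded R fun τ : Traj S A₁ A₂ G.horizon =>
      G.qValue π t (τ.state t.castSucc) (τ.action t) := .state_action t _
  refine (ae_eq_condExp_of_forall_setIntegral_eq hm (hZ.integrable hR)
    (fun s _ _ => (hQ.integrable hR).integrableOn) ?_ ?_).symm
  · rintro s ⟨B, hB, rfl⟩ -
    have h := integral_mul_tdResidual hR π πb t
      (.hist ((t : ℕ) + 1) t.2 (B.indicator fun _ => 1)) (precedesReward_hist t _)
    have hB' : MeasurableSet (Traj.hist (S := S) (A₁ := A₁) (A₂ := A₂) ((t : ℕ) + 1) t.2 ⁻¹' B) :=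
      Traj.measurable_hist _ _ hB
    rw [← sub_eq_zero, ← integral_sub (hQ.integrable hR).integrableOn
      (hZ.integrable hR).integrableOn, ← integral_indicator hB', ← neg_eq_zero, ← integral_neg, ← h]
    refine integral_congr_ae (ae_of_all _ fun τ => ?_)
    by_cases hτ : τ.hist ((t : ℕ) + 1) t.2 ∈ B
    · simp [Set.indicator, hτ, tdResidual]
    · simp [Set.indicator, hτ]
  · refine (Measurable.stronglyMeasurable ?_).aestronglyMeasurable
    exact (measurable_of_finite fun h : Hist S A₁ A₂ ((t : ℕ) + 1) =>
      G.qValue π t (h (Fin.last t)).1 (h (Fin.last t)).2).comp (comap_measurable _)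

/-- Since `Q_t` is the conditional mean, the conditional variance is the conditional expectation of
the squared temporal difference, and the function of the history can be moved inside. -/
theorem integral_mul_condVar (hR : ∀ (s : S) (a : A₁ × A₂), ∀ᵐ r ∂G.reward s a, |r| ≤ R)
    (π πb : PolicyProfile S A₁ A₂) (t : Fin G.horizon) (f : Hist S A₁ A₂ ((t : ℕ) + 1) → ℝ) :
    ∫ τ, f (τ.hist (t + 1) t.2) *
      (Var[fun τ' : Traj S A₁ A₂ G.horizon =>
          τ'.rew t + G.γ * G.stateValue π (t + 1) (τ'.state t.succ); G.law πb |
        MeasurableSpace.comap (Traj.hist ((t : ℕ) + 1) t.2) inferInstance]) τ ∂G.law πb =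
      ∫ τ, f (τ.hist (t + 1) t.2) * G.tdResidual π t τ ^ 2 ∂G.law πb := by
  have hm : MeasurableSpace.comap (Traj.hist (S := S) (A₁ := A₁) (A₂ := A₂) ((t : ℕ) + 1) t.2)
      inferInstance ≤ (inferInstance : MeasurableSpace (Traj S A₁ A₂ G.horizon)) :=
    (Traj.measurable_hist _ _).comap_le
  have hvar : (Var[fun τ' : Traj S A₁ A₂ G.horizon =>
          τ'.rew t + G.γ * G.stateValue π (t + 1) (τ'.state t.succ); G.law πb |
        MeasurableSpace.comap (Traj.hist ((t : ℕ) + 1) t.2) inferInstance]) =ᵐ[G.law πb]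
      (G.law πb)[fun τ => G.tdResidual π t τ ^ 2 |
        MeasurableSpace.comap (Traj.hist ((t : ℕ) + 1) t.2) inferInstance] := by
    refine condExp_congr_ae ?_
    filter_upwards [condExp_reward_add_stateValue hR π πb t] with τ hτ
    simp only [Pi.pow_apply, Pi.sub_apply, hτ, tdResidual]
  have hr : RewardBounded R fun τ => G.tdResidual π t τ ^ 2 := (rewardBounded_tdResidual π t).pow 2
  have hf : RewardBounded R fun τ : Traj S A₁ A₂ G.horizon => f (τ.hist (t + 1) t.2) := .hist _ _ f
  have hpull := condExp_mul_of_stronglyMeasurable_left (μ := G.law πb)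
    (f := fun τ : Traj S A₁ A₂ G.horizon => f (τ.hist (t + 1) t.2))
    (g := fun τ => G.tdResidual π t τ ^ 2)
    (((measurable_of_finite f).comp (comap_measurable
      (Traj.hist (S := S) (A₁ := A₁) (A₂ := A₂) ((t : ℕ) + 1) t.2))).stronglyMeasurable)
    ((hf.mul hr).integrable hR) (hr.integrable hR)
  refine Eq.trans ?_ (integral_condExp hm
    (f := fun τ => f (τ.hist (t + 1) t.2) * G.tdResidual π t τ ^ 2))
  refine integral_congr_ae ?_
  filter_upwards [hvar, hpull] with τ h1 h2
  rw [h1]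
  exact h2.symm

/-- The variance of the score with the true nuisance functions. -/
theorem integral_drScore_sub_sq (hR : ∀ (s : S) (a : A₁ × A₂), ∀ᵐ r ∂G.reward s a, |r| ≤ R)
    (π πb : PolicyProfile S A₁ A₂) :
    ∫ τ, (G.drScore π (fun t => G.qValue π t) (cumRatio π πb) τ - G.value₁ π) ^ 2 ∂G.law πb =
      G.drVariance π πb := by
  have hw : ∀ h : Hist S A₁ A₂ 0, cumRatio π πb 0 h = 1 := fun h => by simp [cumRatio]
  -- The centred score is `A + ∑ M t`. Each `M t` is a martingale difference, orthogonal to `A` and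
  -- to the earlier `M u`, so only the squares contribute to the variance.
  set A : Traj S A₁ A₂ G.horizon → ℝ := fun τ => G.stateValue π 0 (τ.state 0) - G.value₁ π with hA
  set M : Fin G.horizon → Traj S A₁ A₂ G.horizon → ℝ := fun t τ => G.γ ^ (t : ℕ) *
    cumRatio π πb (t + 1) (τ.hist (t + 1) t.2) * G.tdResidual π t τ with hM
  have hAb : RewardBounded R A := (RewardBounded.state 0 _).sub (.const _)
  have hρb : ∀ t : Fin G.horizon, RewardBounded R fun τ : Traj S A₁ A₂ G.horizon =>
      G.γ ^ (t : ℕ) * cumRatio π πb (t + 1) (τ.hist (t + 1) t.2) := fun t =>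
    (RewardBounded.const _).mul (.hist _ _ _)
  have hMb : ∀ t, RewardBounded R (M t) := fun t => (hρb t).mul (rewardBounded_tdResidual π t)
  have hpreM : ∀ u t : Fin G.horizon, u < t → PrecedesReward t (M u) := by
    intro u t h τ τ' hs ha hr
    have h1 := precedesReward_hist u (cumRatio π πb (u + 1)) τ τ'
      (fun i hi => hs i (hi.trans (by simpa using h.le))) (fun i hi => ha i (hi.trans h.le))
      (fun i hi => hr i (hi.trans h))
    simp only [hM]
    have h2 := precedesReward_tdResidual π h τ τ' hs ha hr
    simp only at h1 h2
    rw [h1, h2]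
  have hpreρ : ∀ t : Fin G.horizon, PrecedesReward t fun τ : Traj S A₁ A₂ G.horizon =>
      G.γ ^ (t : ℕ) * cumRatio π πb (t + 1) (τ.hist (t + 1) t.2) := fun t =>
    precedesReward_hist t fun h => G.γ ^ (t : ℕ) * cumRatio π πb (t + 1) h
  have orthA : ∀ t, ∫ τ, A τ * M t τ ∂G.law πb = 0 := by
    intro t
    have := integral_mul_tdResidual hR π πb t (hAb.mul (hρb t)) ?_
    · simpa only [hM, mul_assoc] using this
    · intro τ τ' hs ha hr
      simp only [hpreρ t τ τ' hs ha hr, hA, hs 0 (Fin.zero_le _)]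
  have orth : ∀ u t, u < t → ∫ τ, M u τ * M t τ ∂G.law πb = 0 := by
    intro u t h
    have := integral_mul_tdResidual hR π πb t ((hMb u).mul (hρb t)) ?_
    · simpa only [hM, mul_assoc] using this
    · intro τ τ' hs ha hr
      simp only [hpreρ t τ τ' hs ha hr, hpreM u t h τ τ' hs ha hr]
  have expand : ∀ τ, (G.drScore π (fun t => G.qValue π t) (cumRatio π πb) τ - G.value₁ π) ^ 2 =
      (A τ ^ 2 + 2 * ∑ t, A τ * M t τ) + ∑ u, ∑ t, M u τ * M t τ := by
    intro τ
    have : G.drScore π (fun t => G.qValue π t) (cumRatio π πb) τ - G.value₁ π =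
        A τ + ∑ t, M t τ := by
      simp only [drScore_qValue_eq hR π hw, hA, hM, mul_assoc]
      ring
    rw [this, ← Finset.mul_sum, ← Finset.sum_mul_sum]
    ring
  simp_rw [expand]
  have i2 : RewardBounded R fun τ => ∑ t, A τ * M t τ := .sum _ fun t _ => hAb.mul (hMb t)
  have i3 : ∀ u, RewardBounded R fun τ => ∑ t, M u τ * M t τ := fun u =>
    .sum _ fun t _ => (hMb u).mul (hMb t)
  rw [law, integral_add (((hAb.pow 2).add ((RewardBounded.const 2).mul i2)).integrable hR)
    ((RewardBounded.sum _ fun u _ => i3 u).integrable hR),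
    integral_add ((hAb.pow 2).integrable hR) (((RewardBounded.const 2).mul i2).integrable hR),
    integral_const_mul, integral_finsetSum _ fun t _ => (hAb.mul (hMb t)).integrable hR,
    integral_finsetSum _ fun u _ => (i3 u).integrable hR, ← law]
  simp only [orthA, Finset.sum_const_zero, mul_zero, add_zero]
  rw [drVariance]
  congr 1
  · have hmeas : Measurable fun s => G.stateValue π 0 s := measurable_of_finite _
    rw [variance_eq_integral hmeas.aemeasurable, PMF.integral_eq_sum, PMF.integral_eq_sum]
    simp only [smul_eq_mul, ← value₁_eq_sum_stateValue hR]
    exact integral_state_zero G hR πb 0 G.horizon G.init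
      fun s => (G.stateValue π 0 s - G.value₁ π) ^ 2
  · refine Finset.sum_congr rfl fun t _ => ?_
    rw [law, integral_finsetSum _ fun u _ => ((hMb t).mul (hMb u)).integrable hR, ← law,
      Finset.sum_eq_single t]
    · rw [integral_mul_condVar hR π πb t fun h => G.γ ^ (2 * (t : ℕ)) * cumRatio π πb (t + 1) h ^ 2]
      refine integral_congr_ae (ae_of_all _ fun τ => ?_)
      simp only [hM]
      ring
    · intro u _ hu
      rcases lt_or_gt_of_ne hu with h | h
      · simp_rw [mul_comm (M t _)]
        exact orth u t h
      · exact orth t u h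
    · simp

end MarkovGame

/-! ### Cross-fitting for independent identically distributed samples. -/

section CrossFitting

variable {Ω : Type*} [MeasurableSpace Ω] {μ : Measure Ω}

/-- Convergence to zero in measure is inherited from a finite family that controls the sequence. -/
theorem tendstoInMeasure_zero_of_forall_lt {ι : Type*} [Fintype ι] {Z : ι → ℕ → Ω → ℝ}
    (hZ : ∀ i, TendstoInMeasure μ (Z i) atTop fun _ => (0 : ℝ)) {B : ℕ → Ω → ℝ}
    (h : ∀ ε > 0, ∃ δ > 0, ∀ᶠ n in atTop, ∀ᵐ ω ∂μ, (∀ i, |Z i n ω| < δ) → |B n ω| < ε) :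
    TendstoInMeasure μ B atTop fun _ => (0 : ℝ) := by
  rw [tendstoInMeasure_iff_norm]
  intro ε hε
  obtain ⟨δ, hδ, hev⟩ := h ε hε
  have hsum : Tendsto (fun n => ∑ i, μ {ω | δ ≤ |Z i n ω|}) atTop (nhds 0) := by
    have := tendsto_finsetSum (Finset.univ : Finset ι) fun i _ =>
      tendstoInMeasure_iff_norm.1 (hZ i) δ hδ
    simpa using this
  refine tendsto_of_tendsto_of_tendsto_of_le_of_le' tendsto_const_nhds hsum
    (Eventually.of_forall fun _ => zero_le) ?_
  filter_upwards [hev] with n hn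
  refine (measure_mono_ae (t := ⋃ i, {ω | δ ≤ |Z i n ω|}) ?_).trans
    (measure_iUnion_fintype_le _ _)
  filter_upwards [hn] with ω hω (hB : ε ≤ ‖B n ω - 0‖)
  rw [sub_zero, Real.norm_eq_abs] at hB
  change ω ∈ ⋃ i, {ω | δ ≤ |Z i n ω|}
  by_contra hcon
  simp only [Set.mem_iUnion, Set.mem_ofPred_eq, not_exists, not_le] at hcon
  exact (hω hcon).not_ge hB

variable [IsProbabilityMeasure μ] {E : Type*} [MeasurableSpace E] {P : Measure E}

/-- Chebyshev's inequality for a sum of independent identically distributed variables. -/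
theorem measureReal_le_abs_inv_sqrt_mul_sum {ι : Type*} [Fintype ι] {X : ι → Ω → E}
    (hindep : iIndepFun X μ) (hlaw : ∀ i, HasLaw (X i) P μ) {g : E → ℝ} (hgm : Measurable g)
    (hg : MemLp g 2 P) {N : ℕ} (hN : Fintype.card ι ≤ N) (hN0 : 0 < N) {ε : ℝ} (hε : 0 < ε) :
    μ.real {ω | ε ≤ |(√(N : ℝ))⁻¹ * ∑ i, g (X i ω)|} ≤
      (∫ x, g x ^ 2 ∂P + N * (∫ x, g x ∂P) ^ 2) / ε ^ 2 := by
  have hN' : (0 : ℝ) < N := Nat.cast_pos.2 hN0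
  have hgX : ∀ i, MemLp (fun ω => g (X i ω)) 2 μ := fun i => by
    have := (hlaw i).map_eq
    rw [← this] at hg
    exact (memLp_map_measure_iff hgm.aestronglyMeasurable (hlaw i).aemeasurable).1 hg
  have hmean : ∀ i, ∫ ω, g (X i ω) ∂μ = ∫ x, g x ∂P := fun i =>
    (hlaw i).integral_comp hgm.aestronglyMeasurable
  have hsq : ∀ i, ∫ ω, g (X i ω) ^ 2 ∂μ = ∫ x, g x ^ 2 ∂P := fun i =>
    (hlaw i).integral_comp (f := fun x => g x ^ 2) (hgm.pow_const 2).aestronglyMeasurable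
  set W : Ω → ℝ := ∑ i, fun ω => g (X i ω) with hW
  have hWa : ∀ ω, W ω = ∑ i, g (X i ω) := fun ω => by simp [hW]
  have hW2 : MemLp W 2 μ := memLp_finsetSum' _ fun i _ => hgX i
  have hvar : Var[W; μ] = ∑ i : ι, Var[fun ω => g (X i ω); μ] :=
    IndepFun.variance_sum (fun i _ => hgX i) fun i _ j _ hij =>
      (hindep.indepFun hij).comp hgm hgm
  have hvar_le : Var[W; μ] ≤ N * ∫ x, g x ^ 2 ∂P := by
    rw [hvar]
    calc ∑ i : ι, Var[fun ω => g (X i ω); μ] ≤ ∑ _i : ι, ∫ x, g x ^ 2 ∂P := by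
          refine Finset.sum_le_sum fun i _ => ?_
          rw [← hsq i]
          exact variance_le_expectation_sq (hgX i).aestronglyMeasurable
      _ ≤ N * ∫ x, g x ^ 2 ∂P := by
          rw [Finset.sum_const, nsmul_eq_mul, Finset.card_univ]
          exact mul_le_mul_of_nonneg_right (Nat.cast_le.2 hN) (integral_nonneg fun _ => sq_nonneg _)
  have hWmean : ∫ ω, W ω ∂μ = Fintype.card ι * ∫ x, g x ∂P := by
    simp_rw [hWa]
    rw [integral_finsetSum _ fun i _ => (hgX i).integrable (by norm_num)]
    simp [hmean]
  -- Second moment as variance plus squared mean. `N` will be the full sample size while `ι` is one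
  -- fold, so the number of summands is only bounded by `N`.
  have hW_sq : ∫ ω, W ω ^ 2 ∂μ ≤ N * (∫ x, g x ^ 2 ∂P + N * (∫ x, g x ∂P) ^ 2) := by
    have h1 := variance_eq_sub hW2
    simp only [Pi.pow_apply, hWmean] at h1
    have h2 : ((Fintype.card ι : ℝ) * ∫ x, g x ∂P) ^ 2 ≤ (N * ∫ x, g x ∂P) ^ 2 := by
      rw [mul_pow, mul_pow]
      gcongr
    nlinarith
  have hmarkov := mul_meas_ge_le_integral_of_nonneg (μ := μ) (f := fun ω => W ω ^ 2)
    (ae_of_all _ fun _ => sq_nonneg _) hW2.integrable_sq (N * ε ^ 2)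
  have hset : {ω | ε ≤ |(√(N : ℝ))⁻¹ * ∑ i, g (X i ω)|} = {ω | N * ε ^ 2 ≤ W ω ^ 2} := by
    ext ω
    have hs : 0 < √(N : ℝ) := Real.sqrt_pos.2 hN'
    rw [Set.mem_ofPred_eq, Set.mem_ofPred_eq, ← hWa, abs_mul, abs_of_pos (inv_pos.2 hs),
      inv_mul_eq_div, le_div_iff₀ hs, ← sq_le_sq₀ (by positivity) (abs_nonneg _), sq_abs, mul_pow,
      Real.sq_sqrt hN'.le, mul_comm]
  rw [hset, le_div_iff₀ (by positivity)]
  have := hmarkov.trans hW_sq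
  rw [mul_assoc] at this
  have := le_of_mul_le_mul_left this hN'
  linarith

/-- A sum of independent variables transformed by an independently estimated function. -/
theorem measure_le_abs_inv_sqrt_mul_sum_estimated {ι : Type*} [Fintype ι] {X : ι → Ω → E}
    (hindep : iIndepFun X μ) (hlaw : ∀ i, HasLaw (X i) P μ) [IsProbabilityMeasure P]
    {D : Type*} [MeasurableSpace D] {Y : Ω → D} (hY : AEMeasurable Y μ)
    (hYX : IndepFun Y (fun ω i => X i ω) μ) {Δ : D → E → ℝ}
    (hΔ : Measurable (Function.uncurry Δ)) (hΔ2 : ∀ d, MemLp (Δ d) 2 P)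
    {N : ℕ} (hN : Fintype.card ι ≤ N) (hN0 : 0 < N) {ε : ℝ} (hε : 0 < ε) (δ : ℝ) :
    μ {ω | ε ≤ |(√(N : ℝ))⁻¹ * ∑ i, Δ (Y ω) (X i ω)|} ≤
      μ {ω | δ ≤ |∫ x, Δ (Y ω) x ^ 2 ∂P + N * (∫ x, Δ (Y ω) x ∂P) ^ 2|} +
        ENNReal.ofReal (δ / ε ^ 2) := by
  -- The numerator of Chebyshev's bound with the estimated function frozen at `d`.
  set β : D → ℝ := fun d => ∫ x, Δ d x ^ 2 ∂P + N * (∫ x, Δ d x ∂P) ^ 2 with hβ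
  have hβm : Measurable β := by
    have h1 : Measurable fun d => ∫ x, Δ d x ^ 2 ∂P :=
      (StronglyMeasurable.integral_prod_right (f := fun d x => Δ d x ^ 2)
        (hΔ.pow_const 2).stronglyMeasurable).measurable
    have h2 : Measurable fun d => ∫ x, Δ d x ∂P :=
      (StronglyMeasurable.integral_prod_right (f := Δ) hΔ.stronglyMeasurable).measurable
    exact h1.add ((h2.pow_const 2).const_mul _)
  have hΔd : ∀ d, Measurable (Δ d) := fun d => hΔ.comp measurable_prodMk_left
  have hXm : AEMeasurable (fun ω i => X i ω) μ :=
    aemeasurable_pi_lambda _ fun i => (hlaw i).aemeasurable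
  let A : Set (D × (ι → E)) := {p | ε ≤ |(√(N : ℝ))⁻¹ * ∑ i, Δ p.1 (p.2 i)| ∧ |β p.1| < δ}
  have hsum : Measurable fun p : D × (ι → E) => (√(N : ℝ))⁻¹ * ∑ i, Δ p.1 (p.2 i) := by
    refine (Finset.measurable_fun_sum _ fun i _ => ?_).const_mul _
    exact hΔ.comp (measurable_fst.prodMk ((measurable_pi_apply i).comp measurable_snd))
  have hA : MeasurableSet A :=
    (measurableSet_le measurable_const hsum.abs).inter
      (measurableSet_lt (hβm.comp measurable_fst).abs measurable_const)
  have hAle : μ {ω | (Y ω, fun i => X i ω) ∈ A} ≤ ENNReal.ofReal (δ / ε ^ 2) := by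
    -- By independence the joint law is a product, so Chebyshev's inequality can be applied for each
    -- frozen `d` and then integrated over the law of `Y`; no conditional expectation is needed.
    have hmap := (indepFun_iff_map_prod_eq_prod_map_map hY hXm).1 hYX
    have : μ {ω | (Y ω, fun i => X i ω) ∈ A} =
        μ.map (fun ω => (Y ω, fun i => X i ω)) A :=
      (Measure.map_apply_of_aemeasurable (hY.prodMk hXm) hA).symm
    have : IsProbabilityMeasure (μ.map Y) := Measure.isProbabilityMeasure_map hY
    have : IsProbabilityMeasure (μ.map fun ω i => X i ω) := Measure.isProbabilityMeasure_map hXm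
    rw [‹μ {ω | (Y ω, fun i => X i ω) ∈ A} = _›, hmap, Measure.prod_apply hA]
    calc ∫⁻ d, (μ.map fun ω i => X i ω) (Prod.mk d ⁻¹' A) ∂μ.map Y
        ≤ ∫⁻ _d, ENNReal.ofReal (δ / ε ^ 2) ∂μ.map Y := by
          refine lintegral_mono fun d => ?_
          by_cases hd : |β d| < δ
          · have hle := measureReal_le_abs_inv_sqrt_mul_sum hindep hlaw (hΔd d) (hΔ2 d) hN hN0 hε
            rw [Measure.map_apply_of_aemeasurable hXm (measurable_prodMk_left hA)]
            refine (measure_mono (t := {ω | ε ≤ |(√(N : ℝ))⁻¹ * ∑ i, Δ d (X i ω)|})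
              fun ω hω => hω.1).trans ?_
            rw [← ofReal_measureReal]
            refine ENNReal.ofReal_le_ofReal (hle.trans ?_)
            gcongr
            exact (le_abs_self _).trans hd.le
          · have : Prod.mk d ⁻¹' A = ∅ := by
              ext x
              simp only [A, Set.mem_preimage, Set.mem_ofPred_eq, hd, and_false, Set.mem_empty_iff_false]
            rw [this, measure_empty]
            exact zero_le
      _ = ENNReal.ofReal (δ / ε ^ 2) := by simp
  refine le_trans (measure_mono fun ω hω => ?_) ((measure_union_le _ _).trans
    (add_le_add le_rfl hAle))
  by_cases h : |β (Y ω)| < δ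
  · exact Or.inr ⟨hω, h⟩
  · exact Or.inl (not_lt.1 h)

/-- The cross-fitting lemma: the remainder is negligible if the estimated functions converge to
zero in `L²` and their means vanish faster than `n ^ (-1 / 2)`. -/
theorem tendstoInMeasure_crossFit [IsProbabilityMeasure P] {X : ℕ → Ω → E}
    (hindep : iIndepFun X μ) (hlaw : ∀ i, HasLaw (X i) P μ) {K : ℕ}
    (fold : (n : ℕ) → Fin n → Fin K)
    (Δ : (n : ℕ) → (k : Fin K) → ({i : Fin n // fold n i ≠ k} → E) → E → ℝ)
    (hΔ : ∀ n k, Measurable (Function.uncurry (Δ n k))) (hΔ2 : ∀ n k d, MemLp (Δ n k d) 2 P)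
    (hrate : ∀ k, TendstoInMeasure μ (fun (n : ℕ) ω =>
      ∫ x, Δ n k (trainingData (fold n) k fun i => X i ω) x ^ 2 ∂P +
        n * (∫ x, Δ n k (trainingData (fold n) k fun i => X i ω) x ∂P) ^ 2) atTop
      fun _ => (0 : ℝ)) :
    TendstoInMeasure μ (fun (n : ℕ) ω => (√(n : ℝ))⁻¹ *
      ∑ i : Fin n, Δ n (fold n i) (trainingData (fold n) (fold n i) fun i => X i ω) (X i ω)) atTop
      fun _ => (0 : ℝ) := by
  let Z : Fin K → ℕ → Ω → ℝ := fun k n ω => (√(n : ℝ))⁻¹ *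
    ∑ i : {i : Fin n // fold n i = k}, Δ n k (trainingData (fold n) k fun i => X i ω) (X i ω)
  have hdecomp : ∀ (n : ℕ) ω, (√(n : ℝ))⁻¹ *
      ∑ i : Fin n, Δ n (fold n i) (trainingData (fold n) (fold n i) fun i => X i ω) (X i ω) =
      ∑ k, Z k n ω := by
    intro n ω
    simp only [Z, ← Finset.mul_sum]
    congr 1
    rw [← Fintype.sum_fiberwise (fold n)]
    refine Finset.sum_congr rfl fun k _ => Finset.sum_congr rfl fun i _ => ?_
    obtain ⟨i, rfl⟩ := i
    rfl
  refine tendstoInMeasure_zero_of_forall_lt (Z := Z) (fun k => ?_) fun ε hε => ?_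
  · rw [tendstoInMeasure_iff_norm]
    intro ε hε
    rw [ENNReal.tendsto_nhds_zero]
    intro η hη
    obtain ⟨r, hr0, hr⟩ := ENNReal.lt_iff_exists_nnreal_btwn.1 (ENNReal.half_pos hη.ne')
    have hr0' : (0 : ℝ) < r := NNReal.coe_pos.2 (ENNReal.coe_pos.1 hr0)
    -- With this threshold the Chebyshev bound `δ / ε ^ 2` is exactly `r < η / 2`.
    have hδ : (0 : ℝ) < r * ε ^ 2 := by positivity
    have hev := (ENNReal.tendsto_nhds_zero.1 (tendstoInMeasure_iff_norm.1 (hrate k) _ hδ)) (η / 2)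
      (ENNReal.half_pos hη.ne')
    filter_upwards [hev, eventually_gt_atTop 0] with n hn hn0
    simp only [sub_zero, Real.norm_eq_abs] at hn ⊢
    have hind : iIndepFun (fun i : Fin n => X i) μ := hindep.precomp Fin.val_injective
    -- The training data and the fold use disjoint sets of indices.
    have hYX : IndepFun (fun ω => trainingData (fold n) k fun i => X i ω)
        (fun ω (i : {i : Fin n // fold n i = k}) => X i ω) μ := by
      have h := hind.indepFun_finset₀ (Finset.univ.filter fun i => fold n i ≠ k)
        (Finset.univ.filter fun i => fold n i = k)
        (Finset.disjoint_left.2 fun i h1 h2 =>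
          (Finset.mem_filter.1 h1).2 (Finset.mem_filter.1 h2).2)
        fun i => (hlaw i).aemeasurable
      exact h.comp
        (φ := fun g (i : {i : Fin n // fold n i ≠ k}) => g ⟨i, by simpa using i.2⟩)
        (ψ := fun g (i : {i : Fin n // fold n i = k}) => g ⟨i, by simpa using i.2⟩)
        (measurable_pi_lambda _ fun i => measurable_pi_apply _)
        (measurable_pi_lambda _ fun i => measurable_pi_apply _)
    have hYm : AEMeasurable (fun ω => trainingData (fold n) k fun i => X i ω) μ :=
      aemeasurable_pi_lambda _ fun i => (hlaw i).aemeasurable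
    refine (measure_le_abs_inv_sqrt_mul_sum_estimated
      (hind.precomp (g := fun i : {i : Fin n // fold n i = k} => (i : Fin n))
        Subtype.val_injective) (fun i => hlaw _) hYm hYX
      (hΔ n k) (hΔ2 n k) ?_ hn0 hε (r * ε ^ 2)).trans ?_
    · exact (Fintype.card_subtype_le _).trans_eq (Fintype.card_fin n)
    · refine (add_le_add hn ?_).trans_eq (ENNReal.add_halves η)
      rw [mul_div_cancel_right₀ _ (by positivity), ENNReal.ofReal_coe_nnreal]
      exact hr.le
  -- Dividing by `K + 1` makes the final inequality strict and covers `K = 0`.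
  · refine ⟨ε / (K + 1), by positivity, Eventually.of_forall fun n => ae_of_all _ fun ω h => ?_⟩
    rw [hdecomp]
    calc |∑ k, Z k n ω| ≤ ∑ k, |Z k n ω| := Finset.abs_sum_le_sum_abs _ _
      _ ≤ ∑ _k : Fin K, ε / (K + 1) := Finset.sum_le_sum fun k _ => (h k).le
      _ = K * (ε / (K + 1)) := by simp
      _ < ε := by
        rw [mul_div_assoc', div_lt_iff₀ (by positivity)]
        nlinarith

end CrossFitting

/-! ### Bias and mean square of the error of the score for fixed nuisance estimates. -/

/-- The mean of a function of the joint action under a profile. -/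
noncomputable def PolicyProfile.mean {S A₁ A₂ : Type*} [Fintype A₁] [Fintype A₂]
    (π : PolicyProfile S A₁ A₂) (t : ℕ) (s : S) (g : A₁ × A₂ → ℝ) : ℝ :=
  ∑ a, (π.prob t s a).toReal * g a

/-- Jensen's inequality for the action distribution. -/
theorem PolicyProfile.mean_sq_le {S A₁ A₂ : Type*} [Fintype A₁] [Fintype A₂]
    (π : PolicyProfile S A₁ A₂) (t : ℕ) (s : S) (g : A₁ × A₂ → ℝ) :
    π.mean t s g ^ 2 ≤ π.mean t s fun a => g a ^ 2 := by
  have := (even_two.convexOn_pow (𝕜 := ℝ)).map_sum_le (t := Finset.univ)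
    (w := fun a => (π.prob t s a).toReal) (p := g) (fun _ _ => ENNReal.toReal_nonneg)
    (π.sum_prob_toReal t s) fun _ _ => Set.mem_univ _
  simpa [PolicyProfile.mean] using this

namespace MarkovGame

section Overlap

variable {S A₁ A₂ : Type*} {G : MarkovGame S A₁ A₂} {π πb : PolicyProfile S A₁ A₂} {C : ℝ}

/-- Overlap forces the target probability to vanish wherever the behavior probability does, so the
value `0` of a ratio with zero denominator is harmless. -/
theorem prob_mul_densityRatio
    (hC : ∀ (t : Fin G.horizon) (s : S) (a : A₁ × A₂),
      (π.prob t s a).toReal ≤ C * (πb.prob t s a).toReal)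
    (t : Fin G.horizon) (s : S) (a : A₁ × A₂) :
    (πb.prob t s a).toReal * densityRatio π πb t s a = (π.prob t s a).toReal := by
  rw [densityRatio]
  by_cases h : (πb.prob t s a).toReal = 0
  · have := hC t s a
    rw [h, mul_zero] at this
    rw [h, zero_mul, le_antisymm this ENNReal.toReal_nonneg]
  · rw [mul_div_cancel₀ _ h]

variable [Fintype A₁] [Fintype A₂]

/-- Both profiles have total mass one, so summing the overlap bound over actions at any state gives
the claim. A step is required: for horizon `0` overlap says nothing about `C`. -/
theorem one_le_overlap
    (hC : ∀ (t : Fin G.horizon) (s : S) (a : A₁ × A₂),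
      (π.prob t s a).toReal ≤ C * (πb.prob t s a).toReal)
    (t : Fin G.horizon) : 1 ≤ C := by
  obtain ⟨s, -⟩ := G.init.support_nonempty
  have := Finset.sum_le_sum fun a (_ : a ∈ Finset.univ) => hC t s a
  rwa [← Finset.mul_sum, π.sum_prob_toReal, πb.sum_prob_toReal, mul_one] at this

theorem mean_le_mul_mean
    (hC : ∀ (t : Fin G.horizon) (s : S) (a : A₁ × A₂),
      (π.prob t s a).toReal ≤ C * (πb.prob t s a).toReal)
    (t : Fin G.horizon) (s : S) {g : A₁ × A₂ → ℝ} (hg : ∀ a, 0 ≤ g a) :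
    π.mean t s g ≤ C * πb.mean t s g := by
  rw [PolicyProfile.mean, PolicyProfile.mean, Finset.mul_sum]
  refine Finset.sum_le_sum fun a _ => ?_
  rw [← mul_assoc]
  exact mul_le_mul_of_nonneg_right (hC t s a) (hg a)

/-- The score is affine in `q`, so the reward cancels and only the error of `q` remains. -/
theorem drScore_sub (π : PolicyProfile S A₁ A₂) (q q' : Fin G.horizon → S → A₁ × A₂ → ℝ)
    (w : (l : ℕ) → Hist S A₁ A₂ l → ℝ) (τ : Traj S A₁ A₂ G.horizon) :
    G.drScore π q w τ - G.drScore π q' w τ = ∑ t : Fin G.horizon, G.γ ^ (t : ℕ) *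
      (w t (τ.hist t t.2.le) * π.mean t (τ.state t.castSucc)
          (fun a => q t (τ.state t.castSucc) a - q' t (τ.state t.castSucc) a) -
        w (t + 1) (τ.hist (t + 1) t.2) *
          (q t (τ.state t.castSucc) (τ.action t) - q' t (τ.state t.castSucc) (τ.action t))) := by
  rw [drScore, drScore, ← Finset.sum_sub_distrib]
  refine Finset.sum_congr rfl fun t _ => ?_
  simp only [PolicyProfile.mean, mul_sub, Finset.sum_sub_distrib]
  ring

end Overlap

variable {S A₁ A₂ : Type*} [MeasurableSpace S] [MeasurableSpace A₁] [MeasurableSpace A₂]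
  [Fintype S] [Fintype A₁] [Fintype A₂] {G : MarkovGame S A₁ A₂} {π πb : PolicyProfile S A₁ A₂}

theorem qError_sq (t : Fin G.horizon) (q : S → A₁ × A₂ → ℝ) :
    G.qError π πb t q ^ 2 = ∫ τ, (q (τ.state t.castSucc) (τ.action t) -
      G.qValue π t (τ.state t.castSucc) (τ.action t)) ^ 2 ∂G.law πb :=
  Real.sq_sqrt (integral_nonneg fun _ => sq_nonneg _)

theorem ratioError_sq (t : Fin G.horizon) (w : Hist S A₁ A₂ (t + 1) → ℝ) :
    G.ratioError π πb t w ^ 2 = ∫ τ, (w (τ.hist (t + 1) t.2) -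
      cumRatio π πb (t + 1) (τ.hist (t + 1) t.2)) ^ 2 ∂G.law πb :=
  Real.sq_sqrt (integral_nonneg fun _ => sq_nonneg _)

/-- The mean squared errors of the ratio before the actions are dominated by those after. -/
theorem sum_integral_ratio_sq_le {w : (l : ℕ) → Hist S A₁ A₂ l → ℝ} (hw : ∀ h, w 0 h = 1) :
    ∑ t : Fin G.horizon, ∫ τ, (w t (τ.hist t t.2.le) - cumRatio π πb t (τ.hist t t.2.le)) ^ 2
      ∂G.law πb ≤ ∑ t : Fin G.horizon, G.ratioError π πb t (w (t + 1)) ^ 2 := by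
  -- Mean squared error of the ratio over the first `k` steps. Shifting the index by one drops `E 0
  -- = 0` and adds the nonnegative `E G.horizon`.
  let E : ℕ → ℝ := fun k => if h : k ≤ G.horizon then
    ∫ τ, (w k (τ.hist k h) - cumRatio π πb k (τ.hist k h)) ^ 2 ∂G.law πb else 0
  have hE : ∀ t : Fin G.horizon, E t =
      ∫ τ, (w t (τ.hist t t.2.le) - cumRatio π πb t (τ.hist t t.2.le)) ^ 2 ∂G.law πb :=
    fun t => dif_pos t.2.le
  have hE' : ∀ t : Fin G.horizon, E (t + 1) = G.ratioError π πb t (w (t + 1)) ^ 2 :=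
    fun t => (dif_pos t.2).trans (ratioError_sq t _).symm
  have hE0 : E 0 = 0 := by simp [E, hw, cumRatio]
  have hET : 0 ≤ E G.horizon := by
    simp only [E, le_refl, dite_true]
    exact integral_nonneg fun _ => sq_nonneg _
  simp_rw [← hE, ← hE']
  rw [Fin.sum_univ_eq_sum_range E, Fin.sum_univ_eq_sum_range fun t => E (t + 1)]
  have h1 := Finset.sum_range_succ E G.horizon
  have h2 := Finset.sum_range_succ' E G.horizon
  linarith

variable [MeasurableSingletonClass S] [MeasurableSingletonClass A₁] [MeasurableSingletonClass A₂]
  {C R : ℝ}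

/-- Jensen's inequality moves the square inside the target mean, overlap replaces that mean by `C`
times the behavior mean, and the behavior mean has the same integral as evaluation at the played
action. -/
theorem integral_mean_sq_le (hR : ∀ (s : S) (a : A₁ × A₂), ∀ᵐ r ∂G.reward s a, |r| ≤ R)
    (hC : ∀ (t : Fin G.horizon) (s : S) (a : A₁ × A₂),
      (π.prob t s a).toReal ≤ C * (πb.prob t s a).toReal)
    (t : Fin G.horizon) (g : S → A₁ × A₂ → ℝ) :
    ∫ τ, π.mean t (τ.state t.castSucc) (g (τ.state t.castSucc)) ^ 2 ∂G.law πb ≤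
      C * ∫ τ, g (τ.state t.castSucc) (τ.action t) ^ 2 ∂G.law πb := by
  have h : ∫ τ, (g (τ.state t.castSucc) (τ.action t) ^ 2 -
      πb.mean t (τ.state t.castSucc) fun a => g (τ.state t.castSucc) a ^ 2)
      ∂G.pathLaw πb 0 G.horizon G.init = 0 := by
    simpa only [one_mul, zero_add, PolicyProfile.mean] using integral_mul_action_residual hR πb 0 G.horizon G.init t
      (fun s a => g s a ^ 2) (RewardBounded.const 1) (fun _ _ _ _ _ => rfl)
  have hmean : RewardBounded R fun τ : Traj S A₁ A₂ G.horizon =>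
      πb.mean t (τ.state t.castSucc) fun a => g (τ.state t.castSucc) a ^ 2 :=
    .state t.castSucc fun s => πb.mean t s fun a => g s a ^ 2
  rw [integral_sub ((RewardBounded.state_action t fun s a => g s a ^ 2).integrable hR)
    (hmean.integrable hR), sub_eq_zero] at h
  rw [law, h, ← integral_const_mul]
  refine integral_mono (((RewardBounded.state t.castSucc fun s =>
    π.mean t s (g s)).pow 2).integrable hR) ((hmean.integrable hR).const_mul _) fun τ => ?_
  exact (π.mean_sq_le _ _ _).trans (mean_le_mul_mean hC t _ fun a => sq_nonneg _)

/-- Importance weighting changes the behavior profile into the target profile. -/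
theorem integral_cumRatio_mul (hR : ∀ (s : S) (a : A₁ × A₂), ∀ᵐ r ∂G.reward s a, |r| ≤ R)
    (hC : ∀ (t : Fin G.horizon) (s : S) (a : A₁ × A₂),
      (π.prob t s a).toReal ≤ C * (πb.prob t s a).toReal)
    (t : Fin G.horizon) (g : S → A₁ × A₂ → ℝ) :
    ∫ τ, (cumRatio π πb t (τ.hist t t.2.le) *
        π.mean t (τ.state t.castSucc) (g (τ.state t.castSucc)) -
      cumRatio π πb (t + 1) (τ.hist (t + 1) t.2) * g (τ.state t.castSucc) (τ.action t))
      ∂G.law πb = 0 := by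
  -- Under the behavior profile the mean of density ratio times `g` is the target mean of `g`.
  have h := integral_mul_action_residual hR πb 0 G.horizon G.init t
    (fun s a => densityRatio π πb t s a * g s a)
    (.hist t t.2.le (cumRatio π πb t)) (precedesAction_hist t _)
  rw [← neg_eq_zero, ← integral_neg, law, ← h]
  congr 1
  funext τ
  simp only [zero_add, ← mul_assoc, prob_mul_densityRatio hC, cumRatio_hist_succ, mul_sub,
    PolicyProfile.mean]
  ring

/-- The product structure of the bias of the score. -/
theorem mul_abs_integral_drScore_sub_le
    (hR : ∀ (s : S) (a : A₁ × A₂), ∀ᵐ r ∂G.reward s a, |r| ≤ R)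
    (hC : ∀ (t : Fin G.horizon) (s : S) (a : A₁ × A₂),
      (π.prob t s a).toReal ≤ C * (πb.prob t s a).toReal)
    (q : Fin G.horizon → S → A₁ × A₂ → ℝ) {w : (l : ℕ) → Hist S A₁ A₂ l → ℝ}
    (hw : ∀ h, w 0 h = 1) {x y : ℝ} (hx : 0 ≤ x) (hy : 0 ≤ y) :
    x * y * |∫ τ, (G.drScore π q w τ - G.drScore π (fun t => G.qValue π t) (cumRatio π πb) τ)
      ∂G.law πb| ≤
    (1 + C) * ∑ t, ((x * G.qError π πb t (q t)) ^ 2 +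
      (y * G.ratioError π πb t (w (t + 1))) ^ 2) := by
  have hρ : ∀ h : Hist S A₁ A₂ 0, cumRatio π πb 0 h = 1 := fun h => by simp [cumRatio]
  set d : Fin G.horizon → S → A₁ × A₂ → ℝ := fun t s a => q t s a - G.qValue π t s a with hd
  let u₀ : Fin G.horizon → Traj S A₁ A₂ G.horizon → ℝ := fun t τ =>
    w t (τ.hist t t.2.le) - cumRatio π πb t (τ.hist t t.2.le)
  let u₁ : Fin G.horizon → Traj S A₁ A₂ G.horizon → ℝ := fun t τ =>
    w (t + 1) (τ.hist (t + 1) t.2) - cumRatio π πb (t + 1) (τ.hist (t + 1) t.2)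
  let e₀ : Fin G.horizon → Traj S A₁ A₂ G.horizon → ℝ := fun t τ =>
    π.mean t (τ.state t.castSucc) (d t (τ.state t.castSucc))
  let e₁ : Fin G.horizon → Traj S A₁ A₂ G.horizon → ℝ := fun t τ =>
    d t (τ.state t.castSucc) (τ.action t)
  let ρ₀ : Fin G.horizon → Traj S A₁ A₂ G.horizon → ℝ := fun t τ =>
    cumRatio π πb t (τ.hist t t.2.le)
  let ρ₁ : Fin G.horizon → Traj S A₁ A₂ G.horizon → ℝ := fun t τ =>
    cumRatio π πb (t + 1) (τ.hist (t + 1) t.2)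
  have bu₀ : ∀ t, RewardBounded R (u₀ t) := fun t =>
    .hist t t.2.le fun h => w t h - cumRatio π πb t h
  have bu₁ : ∀ t, RewardBounded R (u₁ t) := fun t =>
    .hist (t + 1) t.2 fun h => w (t + 1) h - cumRatio π πb (t + 1) h
  have be₀ : ∀ t, RewardBounded R (e₀ t) := fun t => .state _ fun s => π.mean t s (d t s)
  have be₁ : ∀ t, RewardBounded R (e₁ t) := fun t => .state_action _ _
  have bρ₀ : ∀ t, RewardBounded R (ρ₀ t) := fun t => .hist t t.2.le _
  have bρ₁ : ∀ t, RewardBounded R (ρ₁ t) := fun t => .hist (t + 1) t.2 _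
  have bcross : ∀ t, RewardBounded R fun τ => u₀ t τ * e₀ t τ - u₁ t τ * e₁ t τ := fun t =>
    ((bu₀ t).mul (be₀ t)).sub ((bu₁ t).mul (be₁ t))
  -- With the true `Q` the mean is the value for both `w` and the true ratio, so the weights may be
  -- taken equal. In the remaining error of `q`, the weight splits into its own error and the true
  -- ratio, and the latter part has mean zero.
  have hmean : ∫ τ, (G.drScore π q w τ - G.drScore π (fun t => G.qValue π t) (cumRatio π πb) τ)
      ∂G.law πb = ∑ t : Fin G.horizon, G.γ ^ (t : ℕ) * ∫ τ, (u₀ t τ * e₀ t τ - u₁ t τ * e₁ t τ) ∂G.law πb := by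
    have bq : ∀ w, RewardBounded R fun τ => G.drScore π (fun t => G.qValue π t) w τ := fun w =>
      rewardBounded_drScore π _ w
    have h1 : ∫ τ, (G.drScore π q w τ - G.drScore π (fun t => G.qValue π t) (cumRatio π πb) τ)
        ∂G.law πb =
        ∫ τ, (G.drScore π q w τ - G.drScore π (fun t => G.qValue π t) w τ) ∂G.law πb := by
      have hq := (rewardBounded_drScore (R := R) π q w).integrable hR (π := πb) (t₀ := 0)
        (p₀ := G.init)
      rw [law, integral_sub hq ((bq _).integrable hR), integral_sub hq ((bq _).integrable hR),
        ← law, integral_drScore_qValue hR π πb hw, integral_drScore_qValue hR π πb hρ]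
    rw [h1]
    simp_rw [drScore_sub]
    have hterm : ∀ (t : Fin G.horizon) τ, w t (τ.hist t t.2.le) * π.mean t (τ.state t.castSucc)
          (fun a => q t (τ.state t.castSucc) a - G.qValue π t (τ.state t.castSucc) a) -
        w (t + 1) (τ.hist (t + 1) t.2) * (q t (τ.state t.castSucc) (τ.action t) -
          G.qValue π t (τ.state t.castSucc) (τ.action t)) =
        (u₀ t τ * e₀ t τ - u₁ t τ * e₁ t τ) + (ρ₀ t τ * e₀ t τ - ρ₁ t τ * e₁ t τ) := by
      intro t τ
      simp only [u₀, u₁, e₀, e₁, ρ₀, ρ₁, hd]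
      ring
    simp_rw [hterm]
    have bρ : ∀ t, RewardBounded R fun τ => ρ₀ t τ * e₀ t τ - ρ₁ t τ * e₁ t τ := fun t =>
      ((bρ₀ t).mul (be₀ t)).sub ((bρ₁ t).mul (be₁ t))
    rw [law, integral_finsetSum _ fun t _ =>
      ((RewardBounded.const _).mul ((bcross t).add (bρ t))).integrable hR]
    refine Finset.sum_congr rfl fun t _ => ?_
    rw [integral_const_mul, integral_add ((bcross t).integrable hR) ((bρ t).integrable hR), ← law,
      integral_cumRatio_mul hR hC t (d t), add_zero]
  -- The arithmetic-geometric mean inequality, `x y |u e| ≤ (y² u² + x² e²) / 2`, distributes the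
  -- scales: `x` and `y` will be `n ^ α₁` and `n ^ α₂`.
  have hterm : ∀ t : Fin G.horizon,
      x * y * |G.γ ^ (t : ℕ) * ∫ τ, (u₀ t τ * e₀ t τ - u₁ t τ * e₁ t τ) ∂G.law πb| ≤
      (y ^ 2 * ∫ τ, u₀ t τ ^ 2 ∂G.law πb + y ^ 2 * ∫ τ, u₁ t τ ^ 2 ∂G.law πb) / 2 +
        (1 + C) * (x * G.qError π πb t (q t)) ^ 2 / 2 := by
    intro t
    have hγ : |G.γ ^ (t : ℕ)| ≤ 1 := by
      rw [abs_pow, abs_of_nonneg G.γ_nonneg]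
      exact pow_le_one₀ G.γ_nonneg G.γ_le_one
    have he₀ : ∫ τ, e₀ t τ ^ 2 ∂G.law πb ≤ C * ∫ τ, e₁ t τ ^ 2 ∂G.law πb :=
      integral_mean_sq_le hR hC t (d t)
    have he₁ : ∫ τ, e₁ t τ ^ 2 ∂G.law πb = G.qError π πb t (q t) ^ 2 := (qError_sq t (q t)).symm
    have b1 : RewardBounded R fun τ => y ^ 2 * u₀ t τ ^ 2 := (RewardBounded.const _).mul ((bu₀ t).pow 2)
    have b2 : RewardBounded R fun τ => y ^ 2 * u₁ t τ ^ 2 := (RewardBounded.const _).mul ((bu₁ t).pow 2)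
    have b3 : RewardBounded R fun τ => x ^ 2 * e₀ t τ ^ 2 := (RewardBounded.const _).mul ((be₀ t).pow 2)
    have b4 : RewardBounded R fun τ => x ^ 2 * e₁ t τ ^ 2 := (RewardBounded.const _).mul ((be₁ t).pow 2)
    calc x * y * |G.γ ^ (t : ℕ) * ∫ τ, (u₀ t τ * e₀ t τ - u₁ t τ * e₁ t τ) ∂G.law πb|
        ≤ x * y * |∫ τ, (u₀ t τ * e₀ t τ - u₁ t τ * e₁ t τ) ∂G.law πb| := by
          rw [abs_mul]
          exact mul_le_mul_of_nonneg_left (mul_le_of_le_one_left (abs_nonneg _) hγ) (by positivity)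
      _ ≤ x * y * ∫ τ, |u₀ t τ * e₀ t τ - u₁ t τ * e₁ t τ| ∂G.law πb :=
          mul_le_mul_of_nonneg_left (abs_integral_le_integral_abs) (by positivity)
      _ = ∫ τ, x * y * |u₀ t τ * e₀ t τ - u₁ t τ * e₁ t τ| ∂G.law πb := (integral_const_mul _ _).symm
      _ ≤ ∫ τ, ((y ^ 2 * u₀ t τ ^ 2 + y ^ 2 * u₁ t τ ^ 2) +
            (x ^ 2 * e₀ t τ ^ 2 + x ^ 2 * e₁ t τ ^ 2)) / 2 ∂G.law πb := by
          refine integral_mono (((bcross t).integrable hR).abs.const_mul _)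
            ((((b1.add b2).add (b3.add b4)).integrable hR).div_const 2) fun τ => ?_
          have hxy : x * y * |u₀ t τ * e₀ t τ - u₁ t τ * e₁ t τ| ≤
              x * y * (|u₀ t τ| * |e₀ t τ| + |u₁ t τ| * |e₁ t τ|) := by
            refine mul_le_mul_of_nonneg_left ?_ (by positivity)
            rw [← abs_mul, ← abs_mul]
            exact abs_sub _ _
          have s1 := sq_nonneg (y * |u₀ t τ| - x * |e₀ t τ|)
          have s2 := sq_nonneg (y * |u₁ t τ| - x * |e₁ t τ|)
          simp only
          rw [← sq_abs (u₀ t τ), ← sq_abs (u₁ t τ), ← sq_abs (e₀ t τ), ← sq_abs (e₁ t τ)]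
          nlinarith
      _ = ((y ^ 2 * ∫ τ, u₀ t τ ^ 2 ∂G.law πb + y ^ 2 * ∫ τ, u₁ t τ ^ 2 ∂G.law πb) +
            (x ^ 2 * ∫ τ, e₀ t τ ^ 2 ∂G.law πb + x ^ 2 * ∫ τ, e₁ t τ ^ 2 ∂G.law πb)) / 2 := by
          rw [integral_div, law, integral_add ((b1.add b2).integrable hR)
            ((b3.add b4).integrable hR), integral_add (b1.integrable hR) (b2.integrable hR),
            integral_add (b3.integrable hR) (b4.integrable hR)]
          simp only [integral_const_mul]
      _ ≤ _ := by
          rw [he₁] at he₀ ⊢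
          have := mul_le_mul_of_nonneg_left he₀ (sq_nonneg x)
          rw [mul_pow]
          linarith
  have hsum := sum_integral_ratio_sq_le (G := G) (π := π) (πb := πb) hw
  have hu₁ : ∀ t, ∫ τ, u₁ t τ ^ 2 ∂G.law πb = G.ratioError π πb t (w (t + 1)) ^ 2 :=
    fun t => (ratioError_sq t _).symm
  rw [hmean]
  calc _ ≤ x * y * ∑ t : Fin G.horizon, |G.γ ^ (t : ℕ) * ∫ τ, (u₀ t τ * e₀ t τ - u₁ t τ * e₁ t τ) ∂G.law πb| :=
        mul_le_mul_of_nonneg_left (Finset.abs_sum_le_sum_abs _ _) (by positivity)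
    _ ≤ ∑ t : Fin G.horizon,
        ((y ^ 2 * ∫ τ, u₀ t τ ^ 2 ∂G.law πb + y ^ 2 * ∫ τ, u₁ t τ ^ 2 ∂G.law πb) / 2 +
        (1 + C) * (x * G.qError π πb t (q t)) ^ 2 / 2) := by
        rw [Finset.mul_sum]
        exact Finset.sum_le_sum fun t _ => hterm t
    _ ≤ _ := by
        simp only [hu₁]
        -- The bound `1 ≤ C` is available only if there is a step; otherwise all sums are empty.
        rcases isEmpty_or_nonempty (Fin G.horizon) with hemp | ⟨⟨t₀⟩⟩
        · simp
        have hC1 := one_le_overlap hC t₀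
        have h2 := mul_le_mul_of_nonneg_left hsum (sq_nonneg y)
        have h3 : 0 ≤ ∑ t, (x * G.qError π πb t (q t)) ^ 2 :=
          Finset.sum_nonneg fun _ _ => sq_nonneg _
        have h4 : 0 ≤ y ^ 2 * ∑ t, G.ratioError π πb t (w (t + 1)) ^ 2 :=
          mul_nonneg (sq_nonneg _) (Finset.sum_nonneg fun _ _ => sq_nonneg _)
        rw [Finset.sum_add_distrib, ← Finset.sum_div, ← Finset.sum_div, Finset.sum_add_distrib,
          ← Finset.mul_sum, ← Finset.mul_sum, ← Finset.mul_sum, Finset.sum_add_distrib]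
        simp only [mul_pow y, ← Finset.mul_sum]
        simp only [u₀] at *
        nlinarith

/-- The mean square of the difference of the scores, for bounded estimates of the ratio. -/
theorem exists_integral_drScore_sub_sq_le
    (hR : ∀ (s : S) (a : A₁ × A₂), ∀ᵐ r ∂G.reward s a, |r| ≤ R)
    (hC : ∀ (t : Fin G.horizon) (s : S) (a : A₁ × A₂),
      (π.prob t s a).toReal ≤ C * (πb.prob t s a).toReal) :
    ∃ L : ℝ, 0 ≤ L ∧ ∀ (q : Fin G.horizon → S → A₁ × A₂ → ℝ) (w : (l : ℕ) → Hist S A₁ A₂ l → ℝ),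
      (∀ h, w 0 h = 1) →
      (∀ (t : Fin G.horizon) (h : Hist S A₁ A₂ (t + 1)),
        0 ≤ w (t + 1) h ∧ w (t + 1) h ≤ C ^ ((t : ℕ) + 1)) →
      ∫ τ, (G.drScore π q w τ - G.drScore π (fun t => G.qValue π t) (cumRatio π πb) τ) ^ 2
        ∂G.law πb ≤
      L * ∑ t, (G.qError π πb t (q t) ^ 2 + G.ratioError π πb t (w (t + 1)) ^ 2) := by
  choose M hM using fun t : Fin G.horizon =>
    (rewardBounded_tdResidual (R := R) π t).bounded
  set M' : ℝ := ∑ t, |M t| with hM'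
  have hMM' : ∀ t, M t ≤ M' := fun t => (le_abs_self _).trans
    (Finset.single_le_sum (f := fun t => |M t|) (fun _ _ => abs_nonneg _) (Finset.mem_univ t))
  rcases isEmpty_or_nonempty (Fin G.horizon) with hemp | ⟨⟨t₀⟩⟩
  · refine ⟨0, le_rfl, fun q w _ _ => ?_⟩
    simp [drScore]
  have hC1 := one_le_overlap hC t₀
  set W : ℝ := C ^ G.horizon with hW
  have hW1 : 1 ≤ W := one_le_pow₀ hC1
  -- The factor `G.horizon` comes from Cauchy-Schwarz over the steps and `3` from the three terms in
  -- each. `M'` bounds the temporal differences and `W` the estimated ratios; `1 + C` collects the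
  -- error of `q` at the played action and its target mean.
  set L : ℝ := G.horizon * (3 * (M' ^ 2 + W ^ 2 * (1 + C))) with hL
  have hL0 : 0 ≤ L := by positivity
  refine ⟨L, hL0, fun q w hw hwC => ?_⟩
  have hρ : ∀ h : Hist S A₁ A₂ 0, cumRatio π πb 0 h = 1 := fun h => by simp [cumRatio]
  have hwW : ∀ (l : ℕ), l ≤ G.horizon → ∀ h : Hist S A₁ A₂ l, |w l h| ≤ W := by
    intro l hl h
    cases l with
    | zero => rwa [hw, abs_one]
    | succ l =>
      obtain ⟨h0, h1⟩ := hwC ⟨l, hl⟩ h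
      rw [abs_of_nonneg h0]
      exact h1.trans (pow_le_pow_right₀ hC1 hl)
  let u : Fin G.horizon → Traj S A₁ A₂ G.horizon → ℝ := fun t τ =>
    w (t + 1) (τ.hist (t + 1) t.2) - cumRatio π πb (t + 1) (τ.hist (t + 1) t.2)
  let d : Fin G.horizon → S → A₁ × A₂ → ℝ := fun t s a => q t s a - G.qValue π t s a
  let e₀ : Fin G.horizon → Traj S A₁ A₂ G.horizon → ℝ := fun t τ =>
    π.mean t (τ.state t.castSucc) (d t (τ.state t.castSucc))
  let e₁ : Fin G.horizon → Traj S A₁ A₂ G.horizon → ℝ := fun t τ =>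
    d t (τ.state t.castSucc) (τ.action t)
  have bu : ∀ t, RewardBounded R (u t) := fun t =>
    .hist (t + 1) t.2 fun h => w (t + 1) h - cumRatio π πb (t + 1) h
  have be₀ : ∀ t, RewardBounded R (e₀ t) := fun t => .state _ fun s => π.mean t s (d t s)
  have be₁ : ∀ t, RewardBounded R (e₁ t) := fun t => .state_action _ _
  -- Passing through the score with true `Q` and weights `w`: errors of the ratio multiply temporal
  -- differences, and errors of `q` multiply estimated ratios, all of which are bounded factors.
  have hdiff : ∀ τ, G.drScore π q w τ - G.drScore π (fun t => G.qValue π t) (cumRatio π πb) τ =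
      ∑ t : Fin G.horizon, G.γ ^ (t : ℕ) * (u t τ * G.tdResidual π t τ +
        (w t (τ.hist t t.2.le) * e₀ t τ - w (t + 1) (τ.hist (t + 1) t.2) * e₁ t τ)) := by
    intro τ
    have h1 := drScore_sub (G := G) π q (fun t => G.qValue π t) w τ
    have h2 := drScore_qValue_eq hR π hw τ
    have h3 := drScore_qValue_eq hR π hρ τ
    simp only [mul_add, Finset.sum_add_distrib]
    rw [← h1, h2, h3]
    simp only [u, sub_mul, mul_sub, Finset.sum_sub_distrib]
    ring
  have hpt : ∀ τ : Traj S A₁ A₂ G.horizon, (∀ j, |τ.rew j| ≤ R) →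
      (G.drScore π q w τ - G.drScore π (fun t => G.qValue π t) (cumRatio π πb) τ) ^ 2 ≤
      G.horizon * ∑ t, 3 * (M' ^ 2 * u t τ ^ 2 + W ^ 2 * e₀ t τ ^ 2 + W ^ 2 * e₁ t τ ^ 2) := by
    intro τ hτ
    rw [hdiff]
    refine sq_sum_le_card_mul_sum_sq.trans ?_
    rw [Finset.card_univ, Fintype.card_fin]
    refine mul_le_mul_of_nonneg_left (Finset.sum_le_sum fun t _ => ?_) (Nat.cast_nonneg _)
    have hγ : (G.γ ^ (t : ℕ)) ^ 2 ≤ 1 :=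
      pow_le_one₀ (pow_nonneg G.γ_nonneg _) (pow_le_one₀ G.γ_nonneg G.γ_le_one)
    have b1 : (u t τ * G.tdResidual π t τ) ^ 2 ≤ M' ^ 2 * u t τ ^ 2 := by
      rw [mul_pow, mul_comm]
      exact mul_le_mul_of_nonneg_right
        (sq_le_sq' (by linarith [(abs_le.1 ((hM t τ hτ).trans (hMM' t))).1])
          (abs_le.1 ((hM t τ hτ).trans (hMM' t))).2) (sq_nonneg _)
    have b2 : (w t (τ.hist t t.2.le) * e₀ t τ) ^ 2 ≤ W ^ 2 * e₀ t τ ^ 2 := by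
      rw [mul_pow]
      have := abs_le.1 (hwW t t.2.le (τ.hist t t.2.le))
      exact mul_le_mul_of_nonneg_right (sq_le_sq' this.1 this.2) (sq_nonneg _)
    have b3 : (w (t + 1) (τ.hist (t + 1) t.2) * e₁ t τ) ^ 2 ≤ W ^ 2 * e₁ t τ ^ 2 := by
      rw [mul_pow]
      have := abs_le.1 (hwW (t + 1) t.2 (τ.hist (t + 1) t.2))
      exact mul_le_mul_of_nonneg_right (sq_le_sq' this.1 this.2) (sq_nonneg _)
    rw [mul_pow]
    refine (mul_le_of_le_one_left (sq_nonneg _) hγ).trans ?_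
    set a := u t τ * G.tdResidual π t τ
    set b := w t (τ.hist t t.2.le) * e₀ t τ
    set c := w (t + 1) (τ.hist (t + 1) t.2) * e₁ t τ
    nlinarith [sq_nonneg (a - b), sq_nonneg (b + c), sq_nonneg (a + c)]
  have bt : ∀ t, RewardBounded R fun τ =>
      3 * (M' ^ 2 * u t τ ^ 2 + W ^ 2 * e₀ t τ ^ 2 + W ^ 2 * e₁ t τ ^ 2) := fun t =>
    (RewardBounded.const 3).mul ((((RewardBounded.const _).mul ((bu t).pow 2)).add
      ((RewardBounded.const _).mul ((be₀ t).pow 2))).add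
      ((RewardBounded.const _).mul ((be₁ t).pow 2)))
  have hterm : ∀ t, ∫ τ, 3 * (M' ^ 2 * u t τ ^ 2 + W ^ 2 * e₀ t τ ^ 2 + W ^ 2 * e₁ t τ ^ 2)
      ∂G.law πb ≤ (3 * (M' ^ 2 + W ^ 2 * (1 + C))) *
        (G.qError π πb t (q t) ^ 2 + G.ratioError π πb t (w (t + 1)) ^ 2) := by
    intro t
    have b1 : RewardBounded R fun τ => M' ^ 2 * u t τ ^ 2 := (RewardBounded.const _).mul ((bu t).pow 2)
    have b2 : RewardBounded R fun τ => W ^ 2 * e₀ t τ ^ 2 := (RewardBounded.const _).mul ((be₀ t).pow 2)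
    have b3 : RewardBounded R fun τ => W ^ 2 * e₁ t τ ^ 2 := (RewardBounded.const _).mul ((be₁ t).pow 2)
    have he₀ : ∫ τ, e₀ t τ ^ 2 ∂G.law πb ≤ C * ∫ τ, e₁ t τ ^ 2 ∂G.law πb :=
      integral_mean_sq_le hR hC t (d t)
    have he₁ : ∫ τ, e₁ t τ ^ 2 ∂G.law πb = G.qError π πb t (q t) ^ 2 := (qError_sq t (q t)).symm
    have hu : ∫ τ, u t τ ^ 2 ∂G.law πb = G.ratioError π πb t (w (t + 1)) ^ 2 :=
      (ratioError_sq t _).symm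
    rw [integral_const_mul, law, integral_add ((b1.add b2).integrable hR) (b3.integrable hR),
      integral_add (b1.integrable hR) (b2.integrable hR)]
    simp only [integral_const_mul]
    rw [← law, hu, he₁]
    rw [he₁] at he₀
    have h1 := mul_le_mul_of_nonneg_left he₀ (sq_nonneg W)
    have h2 : 0 ≤ M' ^ 2 * G.qError π πb t (q t) ^ 2 := by positivity
    have h3 : 0 ≤ W ^ 2 * (1 + C) * G.ratioError π πb t (w (t + 1)) ^ 2 := by positivity
    nlinarith
  calc _ ≤ ∫ τ, (G.horizon : ℝ) *
        ∑ t, 3 * (M' ^ 2 * u t τ ^ 2 + W ^ 2 * e₀ t τ ^ 2 + W ^ 2 * e₁ t τ ^ 2) ∂G.law πb := by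
        refine integral_mono_ae
          ((((rewardBounded_drScore π q w).sub (rewardBounded_drScore π _ _)).pow 2).integrable hR)
          (((RewardBounded.const _).mul (.sum _ fun t _ => bt t)).integrable hR) ?_
        filter_upwards [G.ae_abs_rew_le hR πb 0 G.horizon G.init] with τ hτ using hpt τ hτ
    _ ≤ (G.horizon : ℝ) * ∑ t, (3 * (M' ^ 2 + W ^ 2 * (1 + C))) *
        (G.qError π πb t (q t) ^ 2 + G.ratioError π πb t (w (t + 1)) ^ 2) := by
        rw [integral_const_mul, law, integral_finsetSum _ fun t _ => (bt t).integrable hR]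
        exact mul_le_mul_of_nonneg_left (Finset.sum_le_sum fun t _ => hterm t) (Nat.cast_nonneg _)
    _ = _ := by
        rw [← Finset.mul_sum, hL]
        ring

end MarkovGame

/-! ### Measurability in the training data and convergence of the remainder. -/

theorem measurable_eval_comp {D E X : Type*} [MeasurableSpace D] [MeasurableSpace E]
    [MeasurableSpace X] [Countable X] [MeasurableSingletonClass X] {f : D → X → ℝ}
    (hf : ∀ x, Measurable fun d => f d x) {o : E → X} (ho : Measurable o) :
    Measurable fun p : D × E => f p.1 (o p.2) :=
  -- Measurability in the data for each fixed argument gives joint measurability because the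
  -- observable has countably many values.
  (measurable_from_prod_countable_left (f := fun p : D × X => f p.1 p.2) hf).comp
    (measurable_fst.prodMk (ho.comp measurable_snd))

namespace MarkovGame

variable {S A₁ A₂ : Type*} [MeasurableSpace S] [MeasurableSpace A₁] [MeasurableSpace A₂]
  [Fintype S] [Fintype A₁] [Fintype A₂]
  [MeasurableSingletonClass S] [MeasurableSingletonClass A₁] [MeasurableSingletonClass A₂]
  {G : MarkovGame S A₁ A₂} {π πb : PolicyProfile S A₁ A₂} {C R : ℝ}

/-- Joint measurability of the score in the data of the nuisance estimates and the trajectory. -/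
theorem measurable_drScore {D : Type*} [MeasurableSpace D] (π : PolicyProfile S A₁ A₂)
    {q : D → Fin G.horizon → S → A₁ × A₂ → ℝ} {w : D → (l : ℕ) → Hist S A₁ A₂ l → ℝ}
    (hq : ∀ t s a, Measurable fun d => q d t s a) (hw : ∀ l h, Measurable fun d => w d l h) :
    Measurable fun p : D × Traj S A₁ A₂ G.horizon => G.drScore π (q p.1) (w p.1) p.2 := by
  have hwm : ∀ l (hl : l ≤ G.horizon), Measurable fun p : D × Traj S A₁ A₂ G.horizon =>
      w p.1 l (p.2.hist l hl) := fun l hl =>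
    measurable_eval_comp (hw l) (Traj.measurable_hist l hl)
  have hqm : ∀ t : Fin G.horizon, Measurable fun p : D × Traj S A₁ A₂ G.horizon =>
      q p.1 t (p.2.state t.castSucc) (p.2.action t) := fun t =>
    measurable_eval_comp (f := fun d (x : S × (A₁ × A₂)) => q d t x.1 x.2) (fun x => hq t x.1 x.2)
      ((Traj.measurable_state t.castSucc).prodMk (Traj.measurable_action t))
  have hv : ∀ (t : Fin G.horizon) (s : S), Measurable fun d =>
      ∑ a : A₁ × A₂, (π.prob t s a).toReal * q d t s a := fun t s =>
    Finset.measurable_fun_sum _ fun a _ => (hq t s a).const_mul _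
  have hvm : ∀ t : Fin G.horizon, Measurable fun p : D × Traj S A₁ A₂ G.horizon =>
      ∑ a : A₁ × A₂, (π.prob t (p.2.state t.castSucc) a).toReal *
        q p.1 t (p.2.state t.castSucc) a := by
    intro t
    have h := measurable_eval_comp (f := fun d s => ∑ a : A₁ × A₂, (π.prob t s a).toReal * q d t s a)
      (hv t) (Traj.measurable_state (A₁ := A₁) (A₂ := A₂) t.castSucc)
    exact h
  have hrm : ∀ t : Fin G.horizon, Measurable fun p : D × Traj S A₁ A₂ G.horizon => p.2.rew t :=
    fun t => (Traj.measurable_rew t).comp measurable_snd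
  unfold drScore
  refine Finset.measurable_fun_sum _ fun t _ => Measurable.const_mul ?_ _
  exact ((hwm (t + 1) t.2).mul ((hrm t).sub (hqm t))).add ((hwm t t.2.le).mul (hvm t))

/-- The conditional second moment of the cross-fitting remainder vanishes if the product of the
rates of the nuisance estimates is at least `n ^ (1 / 2)`. -/
theorem tendstoInMeasure_remainder {Ω : Type*} [MeasurableSpace Ω] {μ : Measure Ω}
    (hR : ∀ (s : S) (a : A₁ × A₂), ∀ᵐ r ∂G.reward s a, |r| ≤ R)
    (hC : ∀ (t : Fin G.horizon) (s : S) (a : A₁ × A₂),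
      (π.prob t s a).toReal ≤ C * (πb.prob t s a).toReal)
    {q : ℕ → Ω → Fin G.horizon → S → A₁ × A₂ → ℝ} {w : ℕ → Ω → (l : ℕ) → Hist S A₁ A₂ l → ℝ}
    (hw : ∀ n ω h, w n ω 0 h = 1)
    (hwC : ∀ n, ∀ᵐ ω ∂μ, ∀ (t : Fin G.horizon) (h : Hist S A₁ A₂ (t + 1)),
        0 ≤ w n ω (t + 1) h ∧ w n ω (t + 1) h ≤ C ^ ((t : ℕ) + 1))
    {α₁ α₂ : ℝ} (hα₁ : 0 < α₁) (hα₂ : 0 < α₂) (hα : 1 / 2 ≤ α₁ + α₂)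
    (hq_rate : ∀ t, TendstoInMeasure μ (fun (n : ℕ) ω => (n : ℝ) ^ α₁ * G.qError π πb t (q n ω t))
      atTop fun _ => (0 : ℝ))
    (hw_rate : ∀ t : Fin G.horizon, TendstoInMeasure μ
      (fun (n : ℕ) ω => (n : ℝ) ^ α₂ * G.ratioError π πb t (w n ω (t + 1))) atTop
      fun _ => (0 : ℝ)) :
    TendstoInMeasure μ (fun (n : ℕ) ω =>
      ∫ τ, (G.drScore π (q n ω) (w n ω) τ -
        G.drScore π (fun t => G.qValue π t) (cumRatio π πb) τ) ^ 2 ∂G.law πb +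
      n * (∫ τ, (G.drScore π (q n ω) (w n ω) τ -
        G.drScore π (fun t => G.qValue π t) (cumRatio π πb) τ) ∂G.law πb) ^ 2) atTop
      fun _ => (0 : ℝ) := by
  obtain ⟨L, hL0, hL⟩ := exists_integral_drScore_sub_sq_le (G := G) (π := π) (πb := πb) hR hC
  let Z : Fin G.horizon ⊕ Fin G.horizon → ℕ → Ω → ℝ := Sum.elim
    (fun t n ω => (n : ℝ) ^ α₁ * G.qError π πb t (q n ω t))
    (fun t n ω => (n : ℝ) ^ α₂ * G.ratioError π πb t (w n ω (t + 1)))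
  refine tendstoInMeasure_zero_of_forall_lt (Z := Z)
    (fun i => by cases i; exacts [hq_rate _, hw_rate _]) fun ε hε => ?_
  set T : ℝ := (G.horizon : ℝ) with hT
  have hT0 : 0 ≤ T := Nat.cast_nonneg _
  -- The scaled errors below `δ` give `Γ ≤ 2 T δ²`; the two terms of `B` then come from the mean
  -- square and from the squared bias.
  set B : ℝ := L * (2 * T) + ((1 + C) * (2 * T)) ^ 2 with hB
  have hB0 : 0 ≤ B := by positivity
  -- The cap at `1` allows `δ²` and `δ⁴` to be replaced by `δ`, and `B + 1` keeps the denominator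
  -- positive.
  set δ : ℝ := min 1 (ε / (B + 1)) with hδ
  have hδ0 : 0 < δ := lt_min one_pos (by positivity)
  have hδ1 : δ ≤ 1 := min_le_left _ _
  have hδε : B * δ < ε := by
    have : δ * (B + 1) ≤ ε := (le_div_iff₀ (by positivity)).1 (min_le_right _ _)
    linarith
  refine ⟨δ, hδ0, ?_⟩
  filter_upwards [eventually_ge_atTop 1] with n hn
  filter_upwards [hwC n] with ω hω hZ
  have hn1 : (1 : ℝ) ≤ n := Nat.one_le_cast.2 hn
  set x : ℝ := (n : ℝ) ^ α₁ with hx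
  set y : ℝ := (n : ℝ) ^ α₂ with hy
  have hx1 : 1 ≤ x := Real.one_le_rpow hn1 hα₁.le
  have hy1 : 1 ≤ y := Real.one_le_rpow hn1 hα₂.le
  -- The only place where `α₁ + α₂ ≥ 1/2` enters: the product of the two rates absorbs the factor
  -- `√n` in front of the bias.
  have hxy : √(n : ℝ) ≤ x * y := by
    rw [hx, hy, ← Real.rpow_add (by linarith), Real.sqrt_eq_rpow]
    exact Real.rpow_le_rpow_of_exponent_le hn1 hα
  set Γ : ℝ := ∑ t, ((x * G.qError π πb t (q n ω t)) ^ 2 +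
    (y * G.ratioError π πb t (w n ω (t + 1))) ^ 2) with hΓ
  have hΓ0 : 0 ≤ Γ := Finset.sum_nonneg fun t _ => by positivity
  have hΓδ : Γ ≤ 2 * T * δ ^ 2 := by
    calc Γ ≤ ∑ _t : Fin G.horizon, (δ ^ 2 + δ ^ 2) := by
          refine Finset.sum_le_sum fun t _ => add_le_add ?_ ?_
          · exact (sq_lt_sq' (abs_lt.1 (hZ (Sum.inl t))).1 (abs_lt.1 (hZ (Sum.inl t))).2).le
          · exact (sq_lt_sq' (abs_lt.1 (hZ (Sum.inr t))).1 (abs_lt.1 (hZ (Sum.inr t))).2).le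
      _ = 2 * T * δ ^ 2 := by
          rw [Finset.sum_const, Finset.card_univ, Fintype.card_fin, nsmul_eq_mul]
          ring
  set I₂ : ℝ := ∫ τ, (G.drScore π (q n ω) (w n ω) τ -
    G.drScore π (fun t => G.qValue π t) (cumRatio π πb) τ) ^ 2 ∂G.law πb
  set I₁ : ℝ := ∫ τ, (G.drScore π (q n ω) (w n ω) τ -
    G.drScore π (fun t => G.qValue π t) (cumRatio π πb) τ) ∂G.law πb
  have hI₂0 : 0 ≤ I₂ := integral_nonneg fun _ => sq_nonneg _
  -- Since `x` and `y` are at least `1`, the unscaled errors are bounded by the scaled ones.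
  have hI₂ : I₂ ≤ L * Γ := by
    refine (hL (q n ω) (w n ω) (hw n ω) hω).trans (mul_le_mul_of_nonneg_left ?_ hL0)
    refine Finset.sum_le_sum fun t _ => ?_
    rw [mul_pow, mul_pow]
    exact add_le_add (le_mul_of_one_le_left (sq_nonneg _) (one_le_pow₀ hx1))
      (le_mul_of_one_le_left (sq_nonneg _) (one_le_pow₀ hy1))
  have hI₁ : √(n : ℝ) * |I₁| ≤ (1 + C) * Γ :=
    (mul_le_mul_of_nonneg_right hxy (abs_nonneg _)).trans
      (mul_abs_integral_drScore_sub_le hR hC (q n ω) (hw n ω) (by linarith) (by linarith))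
  have hI₁' : n * I₁ ^ 2 ≤ ((1 + C) * Γ) ^ 2 := by
    have := pow_le_pow_left₀ (by positivity) hI₁ 2
    rwa [mul_pow, Real.sq_sqrt (by linarith), sq_abs] at this
  rw [abs_of_nonneg (by positivity)]
  have hδ2 : δ ^ 2 ≤ δ := by nlinarith
  have hδ4 : (δ ^ 2) ^ 2 ≤ δ := (pow_le_of_le_one (sq_nonneg _) (by nlinarith) two_ne_zero).trans hδ2
  have h1 : L * Γ ≤ L * (2 * T) * δ := by
    calc L * Γ ≤ L * (2 * T * δ ^ 2) := mul_le_mul_of_nonneg_left hΓδ hL0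
      _ ≤ L * (2 * T * δ) := by gcongr
      _ = L * (2 * T) * δ := by ring
  have h2 : ((1 + C) * Γ) ^ 2 ≤ ((1 + C) * (2 * T)) ^ 2 * δ := by
    calc ((1 + C) * Γ) ^ 2 = (1 + C) ^ 2 * Γ ^ 2 := mul_pow _ _ _
      _ ≤ (1 + C) ^ 2 * (2 * T * δ ^ 2) ^ 2 := by gcongr
      _ = ((1 + C) * (2 * T)) ^ 2 * (δ ^ 2) ^ 2 := by ring
      _ ≤ ((1 + C) * (2 * T)) ^ 2 * δ := by gcongr
  calc I₂ + n * I₁ ^ 2 ≤ L * (2 * T) * δ + ((1 + C) * (2 * T)) ^ 2 * δ :=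
        add_le_add (hI₂.trans h1) (hI₁'.trans h2)
    _ = B * δ := by rw [hB]; ring
    _ < ε := hδε

end MarkovGame

/-! ### The main theorem: central limit theorem for the true score plus a negligible remainder. -/

theorem theorem2 {S A₁ A₂ : Type*}
    [Fintype S] [MeasurableSpace S] [MeasurableSingletonClass S]
    [Fintype A₁] [MeasurableSpace A₁] [MeasurableSingletonClass A₁]
    [Fintype A₂] [MeasurableSpace A₂] [MeasurableSingletonClass A₂]
    (G : MarkovGame S A₁ A₂)
    -- the target profile and the behavior profile, with overlap, and bounded rewards
    (π πb : PolicyProfile S A₁ A₂) (C Rmax : ℝ)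
    (hoverlap : ∀ (t : Fin G.horizon) (s : S) (a : A₁ × A₂),
      (π.prob t s a).toReal ≤ C * (πb.prob t s a).toReal)
    (hreward : ∀ (s : S) (a : A₁ × A₂), ∀ᵐ r ∂G.reward s a, |r| ≤ Rmax)
    -- independent trajectories of the behavior profile; the sample of size `n` is `X 0, …, X (n-1)`
    {Ω : Type*} [MeasurableSpace Ω] (μ : Measure Ω) [IsProbabilityMeasure μ]
    (X : ℕ → Ω → Traj S A₁ A₂ G.horizon)
    (hindep : iIndepFun X μ) (hlaw : ∀ i, HasLaw (X i) (G.law πb) μ)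
    -- the split into `K` folds
    {K : ℕ} (fold : (n : ℕ) → Fin n → Fin K) (hfold : ∀ n, IsEvenSplit (fold n))
    -- the nuisance estimates, computed from the data outside fold `k`
    (Qhat : (n : ℕ) → (k : Fin K) → ({i : Fin n // fold n i ≠ k} → Traj S A₁ A₂ G.horizon) →
      Fin G.horizon → S → A₁ × A₂ → ℝ)
    (ρhat : (n : ℕ) → (k : Fin K) → ({i : Fin n // fold n i ≠ k} → Traj S A₁ A₂ G.horizon) →
      (l : ℕ) → Hist S A₁ A₂ l → ℝ)
    (hQmeas : ∀ n k t s a, Measurable fun x => Qhat n k x t s a)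
    (hρmeas : ∀ n k l h, Measurable fun x => ρhat n k x l h)
    (hρzero : ∀ n k x h, ρhat n k x 0 h = 1)
    -- almost sure bounds on the estimates
    (hρbound : ∀ (n : ℕ) (k : Fin K), ∀ᵐ ω ∂μ, ∀ (t : Fin G.horizon) (h : Hist S A₁ A₂ (t + 1)),
      0 ≤ ρhat n k (trainingData (fold n) k fun i => X i ω) (t + 1) h ∧
        ρhat n k (trainingData (fold n) k fun i => X i ω) (t + 1) h ≤ C ^ ((t : ℕ) + 1))
    (hQbound : ∀ (n : ℕ) (k : Fin K), ∀ᵐ ω ∂μ, ∀ (t : Fin G.horizon) (s : S) (a : A₁ × A₂),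
      |Qhat n k (trainingData (fold n) k fun i => X i ω) t s a| ≤
        ((G.horizon : ℝ) - (t : ℕ)) * Rmax)
    -- the rates of convergence
    (α₁ α₂ : ℝ) (hα₁ : 0 < α₁) (hα₂ : 0 < α₂) (hα : 1 / 2 ≤ α₁ + α₂)
    (hQrate : ∀ (k : Fin K) (t : Fin G.horizon),
      TendstoInMeasure μ
        (fun (n : ℕ) ω => (n : ℝ) ^ α₁ *
          G.qError π πb t (Qhat n k (trainingData (fold n) k fun i => X i ω) t))
        atTop (fun _ => (0 : ℝ)))
    (hρrate : ∀ (k : Fin K) (t : Fin G.horizon),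
      TendstoInMeasure μ
        (fun (n : ℕ) ω => (n : ℝ) ^ α₂ *
          G.ratioError π πb t (ρhat n k (trainingData (fold n) k fun i => X i ω) (t + 1)))
        atTop (fun _ => (0 : ℝ))) :
    TendstoInDistribution
        (fun (n : ℕ) ω => √(n : ℝ) *
          (drEstimator₁ G π (fold n) (Qhat n) (ρhat n) (fun i => X i ω) - G.value₁ π))
        atTop (id : ℝ → ℝ) (fun _ => μ) (gaussianReal 0 (G.drVariance π πb).toNNReal) ∧
      TendstoInDistribution
        (fun (n : ℕ) ω => √(n : ℝ) *
          (drEstimator₂ G π (fold n) (Qhat n) (ρhat n) (fun i => X i ω) - G.value₂ π))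
        atTop (id : ℝ → ℝ) (fun _ => μ) (gaussianReal 0 (G.drVariance π πb).toNNReal) := by
  have hR := hreward
  set ψ : Traj S A₁ A₂ G.horizon → ℝ :=
    fun τ => G.drScore π (fun t => G.qValue π t) (cumRatio π πb) τ with hψ
  have hρ : ∀ h : Hist S A₁ A₂ 0, cumRatio π πb 0 h = 1 := fun h => by simp [cumRatio]
  have bψ : RewardBounded Rmax ψ := MarkovGame.rewardBounded_drScore π _ _
  have hψm : Measurable ψ := bψ.measurable
  have hmean : ∫ ω, ψ (X 0 ω) ∂μ = G.value₁ π :=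
    ((hlaw 0).integral_comp hψm.aestronglyMeasurable).trans
      (MarkovGame.integral_drScore_qValue hR π πb hρ)
  have hvar : Var[fun ω => ψ (X 0 ω); μ] = G.drVariance π πb := by
    have hm : AEMeasurable (fun ω => ψ (X 0 ω)) μ := hψm.comp_aemeasurable (hlaw 0).aemeasurable
    rw [variance_eq_integral hm, hmean,
      ← MarkovGame.integral_drScore_sub_sq hR π πb]
    exact (hlaw 0).integral_comp (f := fun τ => (ψ τ - G.value₁ π) ^ 2)
      ((hψm.sub_const _).pow_const 2).aestronglyMeasurable
  have hident : ∀ i, IdentDistrib (fun ω => ψ (X i ω)) (fun ω => ψ (X 0 ω)) μ μ := fun i =>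
    IdentDistrib.comp (u := ψ) ⟨(hlaw i).aemeasurable, (hlaw 0).aemeasurable,
      (hlaw i).map_eq.trans (hlaw 0).map_eq.symm⟩ hψm
  have hψ2 : MemLp (fun ω => ψ (X 0 ω)) 2 μ := by
    have h : MemLp ψ 2 (μ.map (X 0)) := by
      rw [(hlaw 0).map_eq]
      exact bψ.memLp hR 2
    exact (memLp_map_measure_iff hψm.aestronglyMeasurable (hlaw 0).aemeasurable).1 h
  let Δ : (n : ℕ) → (k : Fin K) → ({i : Fin n // fold n i ≠ k} → Traj S A₁ A₂ G.horizon) →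
      Traj S A₁ A₂ G.horizon → ℝ := fun n k d τ =>
    G.drScore π (Qhat n k d) (ρhat n k d) τ - ψ τ
  have hΔm : ∀ n k, Measurable (Function.uncurry (Δ n k)) := fun n k =>
    (MarkovGame.measurable_drScore π (hQmeas n k) (hρmeas n k)).sub (hψm.comp measurable_snd)
  have hrem := tendstoInMeasure_crossFit hindep hlaw fold Δ hΔm
    (fun n k d => ((MarkovGame.rewardBounded_drScore π _ _).sub bψ).memLp hR 2)
    (fun k => MarkovGame.tendstoInMeasure_remainder
      (q := fun n ω => Qhat n k (trainingData (fold n) k fun i => X i ω))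
      (w := fun n ω => ρhat n k (trainingData (fold n) k fun i => X i ω))
      hR hoverlap (fun n ω => hρzero n k _) (fun n => hρbound n k) hα₁ hα₂ hα (hQrate k) (hρrate k))
  have hremm : ∀ n : ℕ, AEMeasurable (fun ω => (√(n : ℝ))⁻¹ * ∑ i : Fin n,
      Δ n (fold n i) (trainingData (fold n) (fold n i) fun i => X i ω) (X i ω)) μ := fun n =>
    (Finset.aemeasurable_fun_sum _ fun i _ => (hΔm n (fold n i)).comp_aemeasurable
      ((aemeasurable_pi_lambda _ fun j => (hlaw _).aemeasurable).prodMk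
        (hlaw i).aemeasurable)).const_mul _
  -- The limit variable is left free so that the second claim can use the reflection: negating a
  -- limit of the form `-x` gives back `id`.
  have main : ∀ Y : ℝ → ℝ, HasLaw Y (gaussianReal 0 (G.drVariance π πb).toNNReal)
      (gaussianReal 0 (G.drVariance π πb).toNNReal) →
      TendstoInDistribution (fun (n : ℕ) ω => √(n : ℝ) *
          (drEstimator₁ G π (fold n) (Qhat n) (ρhat n) (fun i => X i ω) - G.value₁ π))
        atTop Y (fun _ => μ) (gaussianReal 0 (G.drVariance π πb).toNNReal) := by
    intro Y hY
    rw [← hvar] at hY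
    have hclt := tendstoInDistribution_inv_sqrt_mul_sum_sub (X := fun i ω => ψ (X i ω)) hY hψ2
      (hindep.comp (fun _ => ψ) fun _ => hψm) hident
    rw [hvar] at hclt
    -- Slutsky's lemma.
    have hsum := hclt.add_of_tendstoInMeasure_const hrem hremm
    simp only [add_zero] at hsum
    refine hsum.congr (fun n => ae_of_all _ fun ω => ?_) (ae_of_all _ fun _ => rfl)
    simp only [Pi.add_apply, Δ, Finset.sum_sub_distrib, hmean, drEstimator₁,
      Finset.sum_range fun i => ψ (X i ω)]
    rcases Nat.eq_zero_or_pos n with rfl | hn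
    · simp
    have hs : 0 < √(n : ℝ) := Real.sqrt_pos.2 (Nat.cast_pos.2 hn)
    -- Writing `n` as the square of its root makes the identity between the two normalizations, `√n
    -- · n⁻¹` and `(√n)⁻¹`, purely algebraic.
    have hn' : (n : ℝ) = √(n : ℝ) * √(n : ℝ) := (Real.mul_self_sqrt (Nat.cast_nonneg n)).symm
    set s := √(n : ℝ)
    rw [hn']
    field_simp
    ring
  refine ⟨main id HasLaw.id, ?_⟩
  have hneg : HasLaw (fun x : ℝ => -x) (gaussianReal 0 (G.drVariance π πb).toNNReal)
      (gaussianReal 0 (G.drVariance π πb).toNNReal) :=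
    ⟨measurable_neg.aemeasurable, by rw [gaussianReal_map_neg, neg_zero]⟩
  refine ((main _ hneg).continuous_comp (g := fun x : ℝ => -x) continuous_neg).congr
    (fun n => ae_of_all _ fun ω => ?_) (ae_of_all _ fun x => neg_neg x)
  simp only [Function.comp_apply, drEstimator₂, MarkovGame.value₂]
  ring
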